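/- **Model.** Let $G$ be a graph on $n$ nodes. In the asynchronous push-pull protocol a rumor is known at time $0$ to one start node $s$ only. Every node carries a clock that rings at the times of a Poisson process of rate $1$, independently for different nodes; whenever the clock of $v$ rings, $v$ contacts a neighbour $w$ chosen uniformly at random (independently of everything else), and if one of $v,w$ knows the rumor, then both know it from then on. Let $T(G)=T(G,s)\in[0,\infty]$ be the first time at which all nodes know the rumor, and let $\mathbb E[T(G)]$ be its expectation over the protocol only, the graph being fixed. Let $G_{n,p}$ be the random graph on $n$ nodes in which every edge is present independently with probability $p$, write $H_m=\sum_{j=1}^m 1/j$, and let "w.h.p." mean "with probability tending to $1$ as $n\to\infty$". **Theorem.** Let $\alpha:\mathbb N\to\mathbb R$ with $\alpha(n)\to\infty$. There is a constant $C$ such that the following holds. (a) Suppose $p=p(n)=\alpha(n)\ln(n)/n\le 1$ for all large $n$. Then w.h.p. (over the graph) for every start node $$\mathbb E[T(G_{n,p})]=y+\eta\quad\text{with}\quad |y-H_{n-1}|<\sqrt{34/\alpha(n)}\,H_{n-1},\qquad |\eta|\le C\,\frac{\ln n}{n}$$ (in particular the expectation is finite). Moreover, for every function $\psi(n)\to\infty$,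 w.h.p. (over graph and protocol) $$\bigl|T(G_{n,p})-\mathbb E[T(G_{n,p})]\bigr|\le C\,\alpha(n)^{-1/2}\ln(n)+\psi(n),$$ uniformly over the choice of the start node, which may depend on the graph. (b) Both bounds hold for every graph with uniform cuts: call a graph $G$ on $n$ nodes *uniform* if for every set $S$ of nodes the number $e(S,S^c)$ of edges between $S$ and its complement satisfies $$\bigl|e(S,S^c)-q\,|S|(n-|S|)\bigr|\le\sqrt{8/\alpha(n)}\;q\,|S|(n-|S|),\qquad q=\alpha(n)\ln(n)/n .$$ Then for all sufficiently large $n$, every uniform graph $G$ on $n$ nodes and every start node, $\mathbb E[T(G)]$ satisfies the bound of (a) with the same $C$; and for every $\psi(n)\to\infty$ and $\delta>0$, for all sufficiently large $n$, every uniform graph $G$ on $n$ nodes and every start node, $|T(G)-\mathbb E[T(G)]|\le C\alpha(n)^{-1/2}\ln(n)+\psi(n)$ with probability at least $1-\delta$. -/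

import Mathlib

open MeasureTheory ProbabilityTheory Filter Topology
open scoped ENNReal unitInterval

namespace RumorSpreading

/-- The law of the node contacted by `v` at a ring of its clock: uniform on the neighbourhood of
`v`. An isolated node has nobody to contact; it contacts itself, which has no effect. -/
noncomputable def contactLaw {n : ℕ} (G : SimpleGraph (Fin n)) (v : Fin n) : Measure (Fin n) :=
  open scoped Classical in
  if (G.neighborSet v).Nonempty then uniformOn (G.neighborSet v) else Measure.dirac v

/-- A realization of all clocks and contacts. For `ω (v, k) = (x, w)`, `x` is the waiting time
between the `k`-th and the `(k+1)`-st ring of the clock of `v` (between time `0` and the first ring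
if `k = 0`), and `w` is the node that `v` contacts at its `(k+1)`-st ring. -/
abbrev Realization (n : ℕ) : Type := Fin n × ℕ → ℝ × Fin n

/-- The law of clocks and contacts. The waiting times are independent and exponential with
parameter `1`, so the rings of the nodes form independent Poisson processes of rate `1`; the
contacts are independent of the clocks and of each other, and uniform among the neighbours. -/
noncomputable def protocolLaw {n : ℕ} (G : SimpleGraph (Fin n)) : Measure (Realization n) :=
  Measure.infinitePi fun i : Fin n × ℕ => (expMeasure 1).prod (contactLaw G i.1)

/-- The time of the `(k+1)`-st ring of the clock of `v`. -/
def ringTime {n : ℕ} (ω : Realization n) (v : Fin n) (k : ℕ) : ℝ :=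
  ∑ i ∈ Finset.range (k + 1), (ω (v, i)).1

/-- `Informed ω s v t`: the node `v` knows the rumor at time `t`, if it starts at `s` at time `0`.
When the clock of `v` rings, `v` contacts a node `w`; if `v` knows the rumor then `w` learns it
(push), and if `w` knows the rumor then `v` learns it (pull). -/
inductive Informed {n : ℕ} (ω : Realization n) (s : Fin n) : Fin n → ℝ → Prop
  | start (t : ℝ) (ht : 0 ≤ t) : Informed ω s s t
  | push (v : Fin n) (k : ℕ) (t : ℝ) (hv : Informed ω s v (ringTime ω v k))
      (ht : ringTime ω v k ≤ t) : Informed ω s (ω (v, k)).2 t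
  | pull (v : Fin n) (k : ℕ) (t : ℝ) (hw : Informed ω s (ω (v, k)).2 (ringTime ω v k))
      (ht : ringTime ω v k ≤ t) : Informed ω s v t

/-- The spreading time `T`: the first time at which all nodes are informed (`∞` if there is
none). -/
noncomputable def spreadTime {n : ℕ} (s : Fin n) (ω : Realization n) : ℝ≥0∞ :=
  ⨅ (t : ℝ) (_ : ∀ v, Informed ω s v t), ENNReal.ofReal t

/-- The expectation of the spreading time on the graph `G`, over the randomness of the protocol. -/
noncomputable def meanSpreadTime {n : ℕ} (G : SimpleGraph (Fin n)) (s : Fin n) : ℝ≥0∞ :=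
  ∫⁻ ω, spreadTime s ω ∂(protocolLaw G)

/-- With `p = a ln n / n`, the number of edges of `G` between any set `S` of nodes and its
complement is within a factor `1 ± √(8 / a)` of `p |S| (n - |S|)`. -/
def UniformCuts {n : ℕ} (G : SimpleGraph (Fin n)) (a : ℝ) : Prop :=
  open scoped Classical in
  ∀ S : Finset (Fin n),
    |((G.interedges S Sᶜ).card : ℝ) - a * Real.log n / n * S.card * (n - S.card)|
      ≤ √(8 / a) * (a * Real.log n / n * S.card * (n - S.card))

/-- The expectation of the spreading time is finite and equals
`(1 ± √(34 / a)) H_{n-1}` up to an error of at most `C ln n / n`. -/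
def MeanBound {n : ℕ} (C a : ℝ) (G : SimpleGraph (Fin n)) (s : Fin n) : Prop :=
  meanSpreadTime G s ≠ ∞ ∧
    ∃ y : ℝ, |y - (harmonic (n - 1) : ℝ)| < √(34 / a) * (harmonic (n - 1) : ℝ) ∧
      |(meanSpreadTime G s).toReal - y| ≤ C * (Real.log n / n)

/-- The event that the spreading time and its expectation are finite and differ by at most `r`. -/
def concentrationEvent {n : ℕ} (r : ℝ) (G : SimpleGraph (Fin n)) (s : Fin n) :
    Set (Realization n) :=
  {ω | meanSpreadTime G s ≠ ∞ ∧ spreadTime s ω ≠ ∞ ∧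
    |(spreadTime s ω).toReal - (meanSpreadTime G s).toReal| ≤ r}

instance contactLaw_isProbabilityMeasure {n : ℕ} (G : SimpleGraph (Fin n)) (v : Fin n) :
    IsProbabilityMeasure (contactLaw G v) := by
  unfold contactLaw
  split_ifs with h
  · exact isProbabilityMeasure_uniformOn (Set.toFinite _) h
  · infer_instance

instance protocolLaw_isProbabilityMeasure {n : ℕ} (G : SimpleGraph (Fin n)) :
    IsProbabilityMeasure (protocolLaw G) := by
  have := isProbabilityMeasure_expMeasure one_pos
  unfold protocolLaw
  infer_instance

end RumorSpreading

/-!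
A node contacts a given neighbour at rate one over its degree, so the rate at which the set of
informed nodes grows is a sum over the edges leaving it, weighted by inverse degrees. Uniform cuts
pin down both the number of these edges and the degrees. Hence a set of `k` informed nodes grows at
a rate within a factor `1 ± O(α^{-1/2})` of the rate `2 k (n - k) / (n - 1)` in the complete graph,
where the expected spreading time is `(n - 1) / n * H_{n-1}`.

To compare the exponential moments of the spreading times, condition on the first ring: by the
Markov property the protocol starts afresh from the possibly enlarged informed set. Hence a
supersolution of the resulting recursion, a product over `k` of `r_k / (r_k - θ)` with `r_k` bounds
on the growth rates, dominates `𝔼[exp (θ T)]`. Jensen's inequality as `θ → 0` gives the expectation,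
and fixed `θ = ± 1 / 4` gives the tails. That a random graph has uniform cuts follows from the
Chernoff bound for each set and a union bound over all sets.
-/

namespace RumorSpreading

/-! ### The exponential distribution -/

section Exponential

variable {r : ℝ}

lemma expMeasure_eq_withDensity_restrict (r : ℝ) :
    expMeasure r = (volume.restrict (Set.Ioi 0)).withDensity
      fun t => ENNReal.ofReal (r * Real.exp (-(r * t))) := by
  change volume.withDensity (exponentialPDF r) = _
  rw [← withDensity_indicator measurableSet_Ioi]
  refine withDensity_congr_ae ?_
  filter_upwards [Measure.ae_ne volume (0 : ℝ)] with t ht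
  rcases ht.lt_or_gt with h | h
  · rw [exponentialPDF_of_neg h, Set.indicator_of_notMem (Set.notMem_Ioi.2 h.le)]
  · rw [exponentialPDF_of_nonneg h.le, Set.indicator_of_mem (Set.mem_Ioi.2 h)]

lemma ae_pos_expMeasure (r : ℝ) : ∀ᵐ t ∂expMeasure r, 0 < t := by
  rw [expMeasure_eq_withDensity_restrict]
  exact (withDensity_absolutelyContinuous _ _).ae_le (ae_restrict_mem measurableSet_Ioi)

lemma lintegral_exp_neg_mul_expMeasure {c : ℝ} (hr : 0 < r) (hc : 0 < r + c) {f : ℝ → ℝ≥0∞}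
    (hf : Measurable f) :
    ∫⁻ t, ENNReal.ofReal (Real.exp (-(c * t))) * f t ∂expMeasure r =
      ENNReal.ofReal (r / (r + c)) * ∫⁻ t, f t ∂expMeasure (r + c) := by
  simp only [expMeasure_eq_withDensity_restrict]
  rw [lintegral_withDensity_eq_lintegral_mul _ (by fun_prop) (by fun_prop),
    lintegral_withDensity_eq_lintegral_mul _ (by fun_prop) hf,
    ← lintegral_const_mul _ (by fun_prop)]
  refine lintegral_congr fun t => ?_
  rw [Pi.mul_apply, Pi.mul_apply, ← mul_assoc, ← mul_assoc, ← ENNReal.ofReal_mul (by positivity),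
    ← ENNReal.ofReal_mul (by positivity), mul_assoc, ← Real.exp_add]
  congr 2
  field_simp
  ring_nf

lemma lintegral_exp_mul_expMeasure {θ : ℝ} (hr : 0 < r) (hθ : θ < r) :
    ∫⁻ t, ENNReal.ofReal (Real.exp (θ * t)) ∂expMeasure r = ENNReal.ofReal (r / (r - θ)) := by
  have : IsProbabilityMeasure (expMeasure (r + -θ)) :=
    isProbabilityMeasure_expMeasure (by linarith)
  simpa [sub_eq_add_neg] using
    lintegral_exp_neg_mul_expMeasure (c := -θ) (f := 1) hr (by linarith) measurable_const

lemma map_sub_restrict_Ioi_expMeasure {x : ℝ} (hx : 0 ≤ x) :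
    ((expMeasure r).restrict (Set.Ioi x)).map (· - x) =
      ENNReal.ofReal (Real.exp (-(r * x))) • expMeasure r := by
  refine Measure.ext_of_lintegral _ fun f hf => ?_
  rw [lintegral_map hf (by fun_prop), lintegral_smul_measure, expMeasure_eq_withDensity_restrict,
    restrict_withDensity measurableSet_Ioi, Measure.restrict_restrict measurableSet_Ioi,
    Set.Ioi_inter_Ioi, max_eq_left hx,
    lintegral_withDensity_eq_lintegral_mul _ (by fun_prop) (by fun_prop),
    lintegral_withDensity_eq_lintegral_mul _ (by fun_prop) hf, smul_eq_mul,
    ← lintegral_const_mul _ (by fun_prop),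
    ← (measurePreserving_add_right volume x).setLIntegral_comp_preimage measurableSet_Ioi
      (by fun_prop), Set.preimage_add_const_Ioi, sub_self]
  refine lintegral_congr fun t => ?_
  rw [Pi.mul_apply, Pi.mul_apply, ← mul_assoc, ← ENNReal.ofReal_mul (by positivity),
    add_sub_cancel_right, mul_add, neg_add, Real.exp_add]
  ring_nf

end Exponential

/-! ### Infinite product measures -/

section InfinitePi

variable {ι κ : Type*} {X : ι → Type*} [∀ i, MeasurableSpace (X i)]
  (μ : ∀ i, Measure (X i)) [∀ i, IsProbabilityMeasure (μ i)]

lemma map_comp_infinitePi {f : κ → ι} (hf : f.Injective) :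
    (Measure.infinitePi μ).map (fun ω j => ω (f j)) = Measure.infinitePi fun j => μ (f j) := by
  have h : iIndepFun (fun i (ω : ∀ i, X i) => ω i) (Measure.infinitePi μ) :=
    iIndepFun_infinitePi (X := fun _ => id) fun _ => measurable_id
  rw [(iIndepFun_iff_map_fun_eq_infinitePi_map (by fun_prop)).1 (h.precomp hf)]
  simp only [Measure.infinitePi_map_eval]

lemma measurable_piecewise_coordinatewise [DecidableEq ι] (Z : Finset ι) {f : ∀ i, X i → X i}
    (hf : ∀ i, Measurable (f i)) :
    Measurable fun ω : ∀ i, X i => Z.piecewise (fun i => f i (ω i)) ω := by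
  refine measurable_pi_iff.2 fun i => ?_
  by_cases hi : i ∈ Z
  · simp only [hi, Finset.piecewise_eq_of_mem]
    exact (hf i).comp (measurable_pi_apply i)
  · simp only [hi, not_false_eq_true, Finset.piecewise_eq_of_notMem]
    exact measurable_pi_apply i

lemma measurable_update_coordinatewise [DecidableEq ι] {i : ι} {f : X i → X i}
    (hf : Measurable f) : Measurable fun ω : ∀ i, X i => Function.update ω i (f (ω i)) :=
  measurable_update'.comp (measurable_id.prodMk (hf.comp (measurable_pi_apply i)))

lemma measurable_update_prod [DecidableEq ι] (i : ι) :
    Measurable fun q : X i × (∀ i, X i) => Function.update q.2 i q.1 :=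
  measurable_update'.comp measurable_swap

lemma map_update_prod_infinitePi [DecidableEq ι] (i : ι) :
    ((μ i).prod (Measure.infinitePi μ)).map
      (fun q : X i × (∀ i, X i) => Function.update q.2 i q.1) = Measure.infinitePi μ := by
  refine Measure.eq_infinitePi _ fun s t ht => ?_
  have hpre : (fun q : X i × (∀ i, X i) => Function.update q.2 i q.1) ⁻¹' Set.pi s t =
      (if i ∈ s then t i else Set.univ) ×ˢ Set.pi (s.erase i : Finset ι) t := by
    ext ⟨y, ω⟩
    have hite : (y ∈ if i ∈ s then t i else Set.univ) ↔ (i ∈ s → y ∈ t i) := by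
      split_ifs with hi <;> simp [hi]
    simp only [Set.mem_preimage, Set.mem_pi, Set.mem_prod, Finset.mem_coe, Finset.mem_erase, hite]
    refine ⟨fun h => ⟨fun hi => by simpa using h i hi, fun j hj => ?_⟩, fun h j hj => ?_⟩
    · simpa [hj.1] using h j hj.2
    · obtain rfl | hne := eq_or_ne j i
      · simpa using h.1 hj
      · simpa [hne] using h.2 j ⟨hne, hj⟩
  rw [Measure.map_apply (measurable_update_prod i) (.pi s.countable_toSet fun j _ => ht j), hpre,
    Measure.prod_prod, Measure.infinitePi_pi _ fun j _ => ht j]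
  split_ifs with hi
  · exact Finset.mul_prod_erase s (fun j => μ j (t j)) hi
  · rw [Finset.erase_eq_of_notMem hi, measure_univ, one_mul]

lemma map_update_restrict_infinitePi [DecidableEq ι] {i : ι} {A : Set (X i)}
    (hA : MeasurableSet A) {f : X i → X i} (hf : Measurable f) {c : ℝ≥0∞}
    (h : ((μ i).restrict A).map f = c • μ i) :
    ((Measure.infinitePi μ).restrict {ω | ω i ∈ A}).map (fun ω => Function.update ω i (f (ω i))) =
      c • Measure.infinitePi μ := by
  have hm := measurable_update_prod (X := X) i
  have hu := measurable_update_coordinatewise hf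
  have hAi : MeasurableSet {ω : ∀ i, X i | ω i ∈ A} := measurable_pi_apply i hA
  have hpre : (fun q : X i × (∀ i, X i) => Function.update q.2 i q.1) ⁻¹' {ω | ω i ∈ A} =
      A ×ˢ Set.univ := by
    ext q
    simp
  have hcomp : (fun ω => Function.update ω i (f (ω i))) ∘
      (fun q : X i × (∀ i, X i) => Function.update q.2 i q.1) =
      (fun q : X i × (∀ i, X i) => Function.update q.2 i q.1) ∘ Prod.map f id := by
    funext q
    simp
  calc ((Measure.infinitePi μ).restrict {ω | ω i ∈ A}).map
        (fun ω => Function.update ω i (f (ω i)))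
    _ = ((((μ i).restrict A).map f).prod (Measure.infinitePi μ)).map
          fun q : X i × (∀ i, X i) => Function.update q.2 i q.1 := by
      conv_lhs => rw [← map_update_prod_infinitePi μ i]
      rw [Measure.restrict_map hm hAi, hpre, ← Measure.prod_restrict,
        Measure.restrict_univ, Measure.map_map hu hm, hcomp,
        ← Measure.map_map hm (hf.prodMap measurable_id),
        ← Measure.map_prod_map _ _ hf measurable_id, Measure.map_id]
    _ = c • Measure.infinitePi μ := by
      rw [h, Measure.prod_smul_left, Measure.map_smul, map_update_prod_infinitePi]

lemma map_piecewise_restrict_infinitePi [DecidableEq ι] (Z : Finset ι) {A : ∀ i, Set (X i)}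
    (hA : ∀ i, MeasurableSet (A i)) {f : ∀ i, X i → X i} (hf : ∀ i, Measurable (f i))
    {c : ι → ℝ≥0∞} (h : ∀ i, ((μ i).restrict (A i)).map (f i) = c i • μ i) :
    ((Measure.infinitePi μ).restrict (Set.pi Z A)).map
        (fun ω => Z.piecewise (fun i => f i (ω i)) ω) = (∏ i ∈ Z, c i) • Measure.infinitePi μ := by
  induction Z using Finset.induction with
  | empty => simp
  | insert a Z ha ih =>
    have hu := measurable_update_coordinatewise (hf a)
    have hZ : MeasurableSet (Set.pi (Z : Set ι) A) := .pi Z.countable_toSet fun i _ => hA i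
    have hpre : (fun ω : ∀ i, X i => Function.update ω a (f a (ω a))) ⁻¹' Set.pi Z A =
        Set.pi Z A := by
      ext ω
      refine forall₂_congr fun i hi => ?_
      simp only [Function.update_of_ne (ne_of_mem_of_not_mem hi ha)]
    have hcomp : (fun ω : ∀ i, X i => Z.piecewise (fun i => f i (ω i)) ω) ∘
        (fun ω => Function.update ω a (f a (ω a))) =
        fun ω => (insert a Z).piecewise (fun i => f i (ω i)) ω := by
      funext ω i
      obtain rfl | hi := eq_or_ne i a
      · simp [ha]
      · by_cases hiZ : i ∈ Z <;> simp [hi, hiZ]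
    rw [Finset.prod_insert ha, mul_comm, mul_smul, smul_comm, ← ih, ← Measure.map_smul,
      ← Measure.restrict_smul, ← map_update_restrict_infinitePi μ (hA a) (hf a) (h a),
      Measure.restrict_map hu hZ, hpre, Measure.restrict_restrict hZ,
      Measure.map_map (measurable_piecewise_coordinatewise Z hf) hu, hcomp]
    congr 2
    ext ω
    simp [Set.mem_pi, and_comm]

end InfinitePi

variable {n : ℕ}

/-! ### The Markov property at the first ring -/

/-- The law of one waiting time of `v` together with the node contacted at its end. -/
noncomputable def ringLaw (G : SimpleGraph (Fin n)) (v : Fin n) : Measure (ℝ × Fin n) :=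
  (expMeasure 1).prod (contactLaw G v)

instance (G : SimpleGraph (Fin n)) (v : Fin n) : IsProbabilityMeasure (ringLaw G v) := by
  have := isProbabilityMeasure_expMeasure one_pos
  unfold ringLaw
  infer_instance

lemma protocolLaw_eq_infinitePi_ringLaw (G : SimpleGraph (Fin n)) :
    protocolLaw G = Measure.infinitePi fun i : Fin n × ℕ => ringLaw G i.1 := rfl

/-- The event that the clock of `v` is the first to ring. -/
def RingsFirst (v : Fin n) (ω : Realization n) : Prop :=
  ∀ u, u ≠ v → (ω (v, 0)).1 < (ω (u, 0)).1

/-- The number in the original realization of the ring of `u` that has number `k` after the first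
ring of `v` has been removed. -/
def skipIndex (v u : Fin n) (k : ℕ) : ℕ := if u = v then k + 1 else k

/-- What remains of the realization after time `x`, if `v` rings once until then and no other node
rings: the waiting times that are under way at time `x` are shortened by `x`. -/
def residual (v : Fin n) (x : ℝ) (ω : Realization n) : Realization n := fun i =>
  ((ω (i.1, skipIndex v i.1 i.2)).1 - if i.1 ≠ v ∧ i.2 = 0 then x else 0,
    (ω (i.1, skipIndex v i.1 i.2)).2)

lemma skipIndex_injective (v : Fin n) :
    Function.Injective fun i : Fin n × ℕ => (i.1, skipIndex v i.1 i.2) := by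
  rintro ⟨u, k⟩ ⟨u', k'⟩ h
  obtain ⟨rfl, h⟩ := Prod.mk.inj h
  unfold skipIndex at h
  split_ifs at h <;> simp_all

lemma measurable_residual (v : Fin n) :
    Measurable fun q : ℝ × Realization n => residual v q.1 q.2 := by
  refine measurable_pi_iff.2 fun i => ?_
  unfold residual
  split_ifs <;> fun_prop

lemma measurable_residual_const (v : Fin n) (x : ℝ) : Measurable (residual v x) :=
  (measurable_residual v).comp measurable_prodMk_left

lemma measurable_prodMk_residual (v : Fin n) :
    Measurable fun ω : Realization n => (ω (v, 0), residual v (ω (v, 0)).1 ω) := by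
  have h : Measurable fun ω : Realization n => ((ω (v, 0)).1, ω) := by fun_prop
  exact .prodMk (by fun_prop) ((measurable_residual v).comp h)

lemma measurableSet_forall_ne_lt_fst (v : Fin n) (x : ℝ) :
    MeasurableSet {ω : Realization n | ∀ u, u ≠ v → x < (ω (u, 0)).1} := by
  have : {ω : Realization n | ∀ u, u ≠ v → x < (ω (u, 0)).1} =
      ⋂ u, ⋂ (_ : u ≠ v), {ω | x < (ω (u, 0)).1} := by
    ext ω
    simp
  rw [this]
  exact .iInter fun u => .iInter fun _ => measurableSet_lt (by fun_prop) (by fun_prop)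

lemma measurableSet_ringsFirst (v : Fin n) :
    MeasurableSet {ω : Realization n | RingsFirst v ω} := by
  have : {ω : Realization n | RingsFirst v ω} =
      ⋂ u, ⋂ (_ : u ≠ v), {ω | (ω (v, 0)).1 < (ω (u, 0)).1} := by
    ext ω
    simp [RingsFirst]
  rw [this]
  exact .iInter fun u => .iInter fun _ => measurableSet_lt (by fun_prop) (by fun_prop)

lemma map_sub_restrict_ringLaw (G : SimpleGraph (Fin n)) (u : Fin n) {x : ℝ} (hx : 0 ≤ x) :
    ((ringLaw G u).restrict (Set.Ioi x ×ˢ Set.univ)).map (fun y => (y.1 - x, y.2)) =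
      ENNReal.ofReal (Real.exp (-x)) • ringLaw G u := by
  have := isProbabilityMeasure_expMeasure one_pos
  change Measure.map (Prod.map (· - x) id) _ = _
  rw [ringLaw, ← Measure.prod_restrict, Measure.restrict_univ,
    ← Measure.map_prod_map _ _ (by fun_prop) measurable_id, map_sub_restrict_Ioi_expMeasure hx,
    Measure.map_id, one_mul, Measure.prod_smul_left]

lemma map_residual_restrict_protocolLaw (G : SimpleGraph (Fin n)) (v : Fin n) {x : ℝ}
    (hx : 0 ≤ x) :
    ((protocolLaw G).restrict {ω | ∀ u, u ≠ v → x < (ω (u, 0)).1}).map (residual v x) =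
      ENNReal.ofReal (Real.exp (-((n - 1 : ℝ) * x))) • protocolLaw G := by
  set Z : Finset (Fin n × ℕ) := Finset.univ.erase v ×ˢ {0}
  let skip (ω : Realization n) : Realization n := fun i => ω (i.1, skipIndex v i.1 i.2)
  let shift (ω : Realization n) : Realization n := Z.piecewise (fun i => ((ω i).1 - x, (ω i).2)) ω
  have hskip : (protocolLaw G).map skip = protocolLaw G := by
    simp only [protocolLaw_eq_infinitePi_ringLaw]
    exact map_comp_infinitePi (fun i : Fin n × ℕ => ringLaw G i.1) (skipIndex_injective v)
  have hshift : ((protocolLaw G).restrict (Set.pi Z fun _ => Set.Ioi x ×ˢ Set.univ)).map shift =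
      ENNReal.ofReal (Real.exp (-((n - 1 : ℝ) * x))) • protocolLaw G := by
    have hZ : (Z.card : ℝ) = n - 1 := by
      simp [Z, Nat.cast_sub v.pos]
    have h := map_piecewise_restrict_infinitePi (fun i : Fin n × ℕ => ringLaw G i.1) Z
      (fun _ => measurableSet_Ioi.prod .univ) (fun _ => by fun_prop)
      (fun i => map_sub_restrict_ringLaw G i.1 hx)
    rw [Finset.prod_const, ← ENNReal.ofReal_pow (Real.exp_pos _).le, ← Real.exp_nat_mul, hZ,
      mul_neg] at h
    exact h
  have hresidual : residual v x = shift ∘ skip := by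
    funext ω ⟨u, k⟩
    have hi : (u, k) ∈ Z ↔ u ≠ v ∧ k = 0 := by
      simp only [Z, Finset.mem_product, Finset.mem_erase, Finset.mem_univ, and_true,
        Finset.mem_singleton]
    simp only [residual, shift, skip, Function.comp, Finset.piecewise, hi]
    split_ifs <;> simp
  have hevent : {ω : Realization n | ∀ u, u ≠ v → x < (ω (u, 0)).1} =
      skip ⁻¹' Set.pi Z fun _ => Set.Ioi x ×ˢ Set.univ := by
    ext ω
    simp +contextual [skip, Z, Set.mem_pi, skipIndex]
  have hskip_meas : Measurable skip := by fun_prop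
  rw [hresidual, hevent, ← Measure.map_map _ hskip_meas,
    ← Measure.restrict_map hskip_meas, hskip, hshift]
  · exact .pi (Finset.countable_toSet _) fun _ _ => measurableSet_Ioi.prod .univ
  · exact measurable_piecewise_coordinatewise Z
      (f := fun _ (y : ℝ × Fin n) => (y.1 - x, y.2)) fun _ => by fun_prop

lemma setLIntegral_ringsFirst (G : SimpleGraph (Fin n)) (v : Fin n)
    {g : (ℝ × Fin n) × Realization n → ℝ≥0∞} (hg : Measurable g) :
    ∫⁻ ω in {ω | RingsFirst v ω}, g (ω (v, 0), residual v (ω (v, 0)).1 ω) ∂protocolLaw G =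
      ∫⁻ y, ∫⁻ ω in {ω | ∀ u, u ≠ v → y.1 < (ω (u, 0)).1}, g (y, residual v y.1 ω)
        ∂protocolLaw G ∂ringLaw G v := by
  have hupdate := measurable_update_prod (X := fun _ : Fin n × ℕ => ℝ × Fin n) (v, 0)
  have hF : Measurable fun ω : Realization n => {ω | RingsFirst v ω}.indicator
      (fun ω => g (ω (v, 0), residual v (ω (v, 0)).1 ω)) ω :=
    .indicator (hg.comp (measurable_prodMk_residual v)) (measurableSet_ringsFirst v)
  have hres (y : ℝ × Fin n) (ω : Realization n) :
      residual v y.1 (Function.update ω (v, 0) y) = residual v y.1 ω := by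
    funext ⟨u, k⟩
    by_cases hu : u = v <;> simp [residual, skipIndex, hu]
  have hevent (y : ℝ × Fin n) (ω : Realization n) :
      RingsFirst v (Function.update ω (v, 0) y) ↔ ∀ u, u ≠ v → y.1 < (ω (u, 0)).1 := by
    simp +contextual [RingsFirst]
  rw [← lintegral_indicator (measurableSet_ringsFirst v)]
  conv_lhs => rw [protocolLaw_eq_infinitePi_ringLaw, ← map_update_prod_infinitePi _ (v, 0)]
  rw [lintegral_map hF hupdate, lintegral_prod _ (by exact (hF.comp hupdate).aemeasurable)]
  refine lintegral_congr fun y => ?_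
  rw [← lintegral_indicator (measurableSet_forall_ne_lt_fst v y.1)]
  refine lintegral_congr fun ω => ?_
  classical
  rw [Set.indicator_apply, Set.indicator_apply]
  simp only [Set.mem_ofPred_eq, hevent, hres, Function.update_self]

lemma map_restrict_ringsFirst (G : SimpleGraph (Fin n)) (v : Fin n) :
    ((protocolLaw G).restrict {ω | RingsFirst v ω}).map
        (fun ω => (ω (v, 0), residual v (ω (v, 0)).1 ω)) =
      (n : ℝ≥0∞)⁻¹ • ((expMeasure n).prod (contactLaw G v)).prod (protocolLaw G) := by
  have hn : (0 : ℝ) < n := by exact_mod_cast v.pos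
  have := isProbabilityMeasure_expMeasure one_pos
  have := isProbabilityMeasure_expMeasure hn
  refine Measure.ext_of_lintegral _ fun g hg => ?_
  have hg' : Measurable fun y : ℝ × Fin n => ∫⁻ ω, g (y, ω) ∂protocolLaw G :=
    hg.lintegral_prod_right'
  have hinner : ∀ y : ℝ × Fin n, 0 ≤ y.1 →
      ∫⁻ ω in {ω | ∀ u, u ≠ v → y.1 < (ω (u, 0)).1}, g (y, residual v y.1 ω) ∂protocolLaw G =
        ENNReal.ofReal (Real.exp (-((n - 1 : ℝ) * y.1))) * ∫⁻ ω, g (y, ω) ∂protocolLaw G := by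
    intro y hy
    rw [← smul_eq_mul, ← lintegral_smul_measure, ← map_residual_restrict_protocolLaw G v hy,
      lintegral_map (by fun_prop) (measurable_residual_const v y.1)]
  have hpos : ∀ᵐ y ∂ringLaw G v, 0 ≤ y.1 :=
    Measure.quasiMeasurePreserving_fst.ae ((ae_pos_expMeasure 1).mono fun _ => le_of_lt)
  rw [lintegral_map hg (measurable_prodMk_residual v),
    setLIntegral_ringsFirst G v hg, lintegral_congr_ae (hpos.mono hinner), ringLaw,
    lintegral_prod _ (by fun_prop), lintegral_smul_measure, smul_eq_mul,
    lintegral_prod _ (by fun_prop), lintegral_prod _ hg'.aemeasurable]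
  simp only [lintegral_const_mul' _ _ ENNReal.ofReal_ne_top]
  rw [lintegral_exp_neg_mul_expMeasure one_pos (by linarith) hg'.lintegral_prod_right',
    add_sub_cancel, one_div, ENNReal.ofReal_inv_of_pos hn, ENNReal.ofReal_natCast]

/-! ### The protocol after the first ring -/

/-- The set of informed nodes after `v` has contacted `w`, if it was `S` before. -/
def absorb (S : Finset (Fin n)) (v w : Fin n) : Finset (Fin n) :=
  if v ∈ S ∨ w ∈ S then insert v (insert w S) else S

/-- The times at which every node is informed, for a rumor known to all nodes of `S` at
time `0`. -/
def coverTimes (ω : Realization n) (S : Finset (Fin n)) : Set ℝ :=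
  {t | ∀ u, ∃ s ∈ S, Informed ω s u t}

/-- All waiting times are positive; this holds almost surely. -/
def PositiveWaits (ω : Realization n) : Prop := ∀ i, 0 < (ω i).1

lemma subset_absorb (S : Finset (Fin n)) (v w : Fin n) : S ⊆ absorb S v w := by
  unfold absorb
  split_ifs
  · exact (Finset.subset_insert w S).trans (Finset.subset_insert v _)
  · exact subset_rfl

lemma mem_absorb_iff (S : Finset (Fin n)) (v w : Fin n) :
    v ∈ absorb S v w ↔ w ∈ absorb S v w := by
  unfold absorb
  split_ifs with h
  · simp
  · rw [not_or] at h
    simp [h]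

section FirstRing

variable {ω : Realization n} {v u : Fin n} {S : Finset (Fin n)} {t : ℝ}

lemma PositiveWaits.ringTime_pos (hω : PositiveWaits ω) (u : Fin n) (k : ℕ) :
    0 < ringTime ω u k :=
  Finset.sum_pos (fun _ _ => hω _) Finset.nonempty_range_add_one

lemma PositiveWaits.nonneg_of_informed {s : Fin n} (hω : PositiveWaits ω)
    (h : Informed ω s u t) : 0 ≤ t := by
  cases h with
  | start _ ht => exact ht
  | push u k _ _ hkt => exact (hω.ringTime_pos u k).le.trans hkt
  | pull _ k _ _ hkt => exact (hω.ringTime_pos _ k).le.trans hkt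

lemma RingsFirst.unique {w : Fin n} (hv : RingsFirst v ω) (hw : RingsFirst w ω) : v = w := by
  by_contra h
  exact lt_asymm (hv w (Ne.symm h)) (hw v h)

lemma RingsFirst.positiveWaits_residual (hv : RingsFirst v ω) (hω : PositiveWaits ω) :
    PositiveWaits (residual v (ω (v, 0)).1 ω) := by
  rintro ⟨u, k⟩
  unfold residual
  dsimp only
  split_ifs with h
  · obtain ⟨hu, rfl⟩ := h
    simpa [skipIndex, hu] using hv u hu
  · simpa using hω _

lemma ringTime_zero (ω : Realization n) (v : Fin n) : ringTime ω v 0 = (ω (v, 0)).1 := by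
  simp [ringTime]

lemma ringTime_skipIndex (ω : Realization n) (v u : Fin n) (k : ℕ) :
    ringTime ω u (skipIndex v u k) = (ω (v, 0)).1 + ringTime (residual v (ω (v, 0)).1 ω) u k := by
  unfold ringTime skipIndex residual
  obtain rfl | hu := eq_or_ne u v
  · rw [if_pos rfl, Finset.sum_range_succ', add_comm]
    simp [skipIndex]
  · simp [Finset.sum_range_succ', skipIndex, hu]

lemma eq_zero_or_exists_eq_skipIndex (v u : Fin n) (k : ℕ) :
    u = v ∧ k = 0 ∨ ∃ j, k = skipIndex v u j := by
  unfold skipIndex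
  obtain rfl | hu := eq_or_ne u v
  · cases k <;> simp
  · simp [hu]

lemma RingsFirst.le_ringTime (hv : RingsFirst v ω) (hω : PositiveWaits ω) (u : Fin n) (k : ℕ) :
    (ω (v, 0)).1 ≤ ringTime ω u k := by
  obtain ⟨rfl, rfl⟩ | ⟨j, rfl⟩ := eq_zero_or_exists_eq_skipIndex v u k
  · exact (ringTime_zero ω u).ge
  · rw [ringTime_skipIndex]
    exact le_add_of_nonneg_right ((hv.positiveWaits_residual hω).ringTime_pos u j).le

lemma RingsFirst.eq_of_informed_of_lt {s : Fin n} (hv : RingsFirst v ω) (hω : PositiveWaits ω)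
    (h : Informed ω s u t) (ht : t < (ω (v, 0)).1) : u = s := by
  cases h with
  | start => rfl
  | push u k t _ hkt => exact absurd ((hv.le_ringTime hω u k).trans hkt) ht.not_ge
  | pull u k t _ hkt => exact absurd ((hv.le_ringTime hω u k).trans hkt) ht.not_ge

lemma RingsFirst.informed_residual {s : Fin n} (hv : RingsFirst v ω) (hω : PositiveWaits ω)
    (hs : s ∈ S) (h : Informed ω s u t) :
    (t ≤ (ω (v, 0)).1 → u ∈ absorb S v (ω (v, 0)).2) ∧
      ((ω (v, 0)).1 ≤ t → ∃ s' ∈ absorb S v (ω (v, 0)).2,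
        Informed (residual v (ω (v, 0)).1 ω) s' u (t - (ω (v, 0)).1)) := by
  set x := (ω (v, 0)).1
  set A := absorb S v (ω (v, 0)).2
  have hlt (u : Fin n) (j : ℕ) : x < ringTime ω u (skipIndex v u j) := by
    rw [ringTime_skipIndex]
    exact lt_add_of_pos_right x ((hv.positiveWaits_residual hω).ringTime_pos u j)
  have of_mem {u : Fin n} {t : ℝ} (hu : u ∈ A) :
      (t ≤ x → u ∈ A) ∧ (x ≤ t → ∃ s' ∈ A, Informed (residual v x ω) s' u (t - x)) :=
    ⟨fun _ => hu, fun ht => ⟨u, hu, .start _ (sub_nonneg.2 ht)⟩⟩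
  induction h with
  | start t _ => exact of_mem (subset_absorb _ _ _ hs)
  | push u k t _ hkt ih =>
    obtain ⟨rfl, rfl⟩ | ⟨j, rfl⟩ := eq_zero_or_exists_eq_skipIndex v u k
    · exact of_mem ((mem_absorb_iff _ _ _).1 (ih.1 (ringTime_zero ω u).le))
    · obtain ⟨s', hs', h⟩ := ih.2 (hlt u j).le
      rw [ringTime_skipIndex, add_sub_cancel_left] at h
      rw [ringTime_skipIndex] at hkt
      exact ⟨fun ht => by linarith [hlt u j, ringTime_skipIndex ω v u j],
        fun _ => ⟨s', hs', .push u j _ h (by linarith)⟩⟩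
  | pull u k t _ hkt ih =>
    obtain ⟨rfl, rfl⟩ | ⟨j, rfl⟩ := eq_zero_or_exists_eq_skipIndex v u k
    · exact of_mem ((mem_absorb_iff _ _ _).2 (ih.1 (ringTime_zero ω u).le))
    · obtain ⟨s', hs', h⟩ := ih.2 (hlt u j).le
      rw [ringTime_skipIndex, add_sub_cancel_left] at h
      rw [ringTime_skipIndex] at hkt
      exact ⟨fun ht => by linarith [hlt u j, ringTime_skipIndex ω v u j],
        fun _ => ⟨s', hs', .pull u j _ h (by linarith)⟩⟩

lemma exists_informed_of_mem_absorb (hx : 0 ≤ (ω (v, 0)).1)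
    (hu : u ∈ absorb S v (ω (v, 0)).2) (ht : (ω (v, 0)).1 ≤ t) : ∃ s ∈ S, Informed ω s u t := by
  have hring := ringTime_zero ω v
  unfold absorb at hu
  split_ifs at hu with hS
  · obtain ⟨s, hs, hvs⟩ : ∃ s ∈ S, Informed ω s v (ringTime ω v 0) := by
      rcases hS with hS | hS
      · exact ⟨v, hS, .start _ (hring ▸ hx)⟩
      · exact ⟨_, hS, .pull v 0 _ (.start _ (hring ▸ hx)) le_rfl⟩
    simp only [Finset.mem_insert] at hu
    obtain rfl | rfl | hu := hu
    · exact ⟨s, hs, .pull u 0 _ (.push u 0 _ hvs le_rfl) (hring ▸ ht)⟩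
    · exact ⟨s, hs, .push v 0 _ hvs (hring ▸ ht)⟩
    · exact ⟨u, hu, .start _ (hx.trans ht)⟩
  · exact ⟨u, hu, .start _ (hx.trans ht)⟩

lemma exists_informed_of_informed_residual {s : Fin n} (hx : 0 ≤ (ω (v, 0)).1)
    (hs : s ∈ absorb S v (ω (v, 0)).2) (h : Informed (residual v (ω (v, 0)).1 ω) s u t) :
    ∃ s' ∈ S, Informed ω s' u ((ω (v, 0)).1 + t) := by
  induction h with
  | start t ht => exact exists_informed_of_mem_absorb hx hs (le_add_of_nonneg_right ht)
  | push u k t _ hkt ih =>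
    obtain ⟨s', hs', h⟩ := ih
    rw [← ringTime_skipIndex] at h
    exact ⟨s', hs', .push u _ _ h (by rw [ringTime_skipIndex]; linarith)⟩
  | pull u k t _ hkt ih =>
    obtain ⟨s', hs', h⟩ := ih
    rw [← ringTime_skipIndex] at h
    exact ⟨s', hs', .pull u _ _ h (by rw [ringTime_skipIndex]; linarith)⟩

lemma RingsFirst.coverTimes_eq_image (hv : RingsFirst v ω) (hω : PositiveWaits ω)
    (hS : S ≠ Finset.univ) :
    coverTimes ω S = ((ω (v, 0)).1 + ·) ''
      coverTimes (residual v (ω (v, 0)).1 ω) (absorb S v (ω (v, 0)).2) := by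
  ext t
  constructor
  · intro h
    have ht : (ω (v, 0)).1 ≤ t := by
      by_contra! hlt
      refine hS (Finset.eq_univ_iff_forall.2 fun u => ?_)
      obtain ⟨s, hs, hsu⟩ := h u
      rwa [hv.eq_of_informed_of_lt hω hsu hlt]
    refine ⟨t - (ω (v, 0)).1, fun u => ?_, add_sub_cancel _ _⟩
    obtain ⟨s, hs, hsu⟩ := h u
    exact (hv.informed_residual hω hs hsu).2 ht
  · rintro ⟨t, h, rfl⟩ u
    obtain ⟨s, hs, hsu⟩ := h u
    exact exists_informed_of_informed_residual (hω _).le hs hsu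

lemma PositiveWaits.nonneg_of_mem_coverTimes [NeZero n] (hω : PositiveWaits ω)
    (ht : t ∈ coverTimes ω S) : 0 ≤ t := by
  obtain ⟨s, -, h⟩ := ht 0
  exact hω.nonneg_of_informed h

lemma isLeast_coverTimes_univ [NeZero n] (hω : PositiveWaits ω) :
    IsLeast (coverTimes ω Finset.univ) 0 :=
  ⟨fun u => ⟨u, Finset.mem_univ u, .start 0 le_rfl⟩, fun _ => hω.nonneg_of_mem_coverTimes⟩

lemma spreadTime_eq_of_isLeast {s : Fin n} {Y : ℝ} (h : IsLeast (coverTimes ω {s}) Y) :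
    spreadTime s ω = ENNReal.ofReal Y := by
  have hiff (t : ℝ) : t ∈ coverTimes ω {s} ↔ ∀ u, Informed ω s u t := by simp [coverTimes]
  exact le_antisymm (iInf₂_le Y ((hiff Y).1 h.1))
    (le_iInf₂ fun t ht => ENNReal.ofReal_le_ofReal (h.2 ((hiff t).2 ht)))

end FirstRing

/-! ### Almost sure properties of the rings -/

lemma ae_positiveWaits (G : SimpleGraph (Fin n)) : ∀ᵐ ω ∂protocolLaw G, PositiveWaits ω := by
  have := isProbabilityMeasure_expMeasure one_pos
  refine ae_all_iff.2 fun i => ?_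
  have hfst : ∀ᵐ y ∂ringLaw G i.1, 0 < y.1 :=
    Measure.quasiMeasurePreserving_fst.ae (ae_pos_expMeasure 1)
  have heval := measurePreserving_eval_infinitePi (fun i : Fin n × ℕ => ringLaw G i.1) i
  exact heval.quasiMeasurePreserving.ae hfst

lemma protocolLaw_ringsFirst (G : SimpleGraph (Fin n)) (v : Fin n) :
    protocolLaw G {ω | RingsFirst v ω} = (n : ℝ≥0∞)⁻¹ := by
  have := isProbabilityMeasure_expMeasure (r := n) (by exact_mod_cast v.pos)
  have h := congrArg (· Set.univ) (map_restrict_ringsFirst G v)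
  simpa [Measure.map_apply (measurable_prodMk_residual v) .univ] using h

lemma ae_exists_ringsFirst [NeZero n] (G : SimpleGraph (Fin n)) :
    ∀ᵐ ω ∂protocolLaw G, ∃ v, RingsFirst v ω := by
  have hdisj : Pairwise (Function.onFun Disjoint fun v : Fin n => {ω | RingsFirst v ω}) :=
    fun v w hvw => Set.disjoint_left.2 fun ω hv hw => hvw (RingsFirst.unique hv hw)
  have hunion : protocolLaw G (⋃ v, {ω | RingsFirst v ω}) = 1 := by
    rw [measure_iUnion hdisj measurableSet_ringsFirst, tsum_fintype]
    simp [protocolLaw_ringsFirst,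
      ENNReal.mul_inv_cancel (Nat.cast_ne_zero.2 (NeZero.ne n)) (ENNReal.natCast_ne_top n)]
  have hmem := (mem_ae_iff_prob_eq_one (MeasurableSet.iUnion measurableSet_ringsFirst)).2 hunion
  filter_upwards [hmem] with ω hω using Set.mem_iUnion.1 hω

lemma ae_residual (G : SimpleGraph (Fin n)) {q : Realization n → Prop}
    (hq : ∀ᵐ ω ∂protocolLaw G, q ω) :
    ∀ᵐ ω ∂protocolLaw G, ∀ v, RingsFirst v ω → q (residual v (ω (v, 0)).1 ω) := by
  refine ae_all_iff.2 fun v => ?_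
  have := isProbabilityMeasure_expMeasure (r := n) (by exact_mod_cast v.pos)
  have hprod : ∀ᵐ y ∂((expMeasure n).prod (contactLaw G v)).prod (protocolLaw G), q y.2 :=
    Measure.quasiMeasurePreserving_snd.ae hq
  have hmap := Measure.ae_smul_measure hprod (n : ℝ≥0∞)⁻¹
  rw [← map_restrict_ringsFirst] at hmap
  exact (ae_restrict_iff' (measurableSet_ringsFirst v)).1
    (ae_of_ae_map (measurable_prodMk_residual v).aemeasurable hmap)

/-! ### Functionals of the sequence of rings -/

/-- The transition operator of the informed set: the expectation of `b` at the set of informed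
nodes after one ring, if it was `S` before. -/
noncomputable def ringStep (G : SimpleGraph (Fin n)) (b : Finset (Fin n) → ℝ≥0∞)
    (S : Finset (Fin n)) : ℝ≥0∞ :=
  (n : ℝ≥0∞)⁻¹ * ∑ v, ∫⁻ w, b (absorb S v w) ∂contactLaw G v

/-- Follow the protocol until all nodes are informed, but for at most `m` rings; multiply the
weights `h x` of the times `x` between the rings with the value `c S` of the final set `S`. -/
noncomputable def ringFunctional (h : ℝ → ℝ≥0∞) (c : Finset (Fin n) → ℝ≥0∞) :
    ℕ → Finset (Fin n) → Realization n → ℝ≥0∞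
  | 0, S, _ => c S
  | m + 1, S, ω => if S = Finset.univ then c S else
      ∑ v, {ω | RingsFirst v ω}.indicator (fun ω => h (ω (v, 0)).1 *
        ringFunctional h c m (absorb S v (ω (v, 0)).2) (residual v (ω (v, 0)).1 ω)) ω

section RingFunctional

variable {h : ℝ → ℝ≥0∞} {c : Finset (Fin n) → ℝ≥0∞}

lemma measurable_mul_absorb (hh : Measurable h)
    {f : Finset (Fin n) → Realization n → ℝ≥0∞} (hf : ∀ S, Measurable (f S))
    (S : Finset (Fin n)) (v : Fin n) :
    Measurable fun y : (ℝ × Fin n) × Realization n => h y.1.1 * f (absorb S v y.1.2) y.2 := by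
  have h1 : Measurable fun z : Realization n × Fin n => f (absorb S v z.2) z.1 :=
    measurable_from_prod_countable_left fun w => hf (absorb S v w)
  have h2 : Measurable fun y : (ℝ × Fin n) × Realization n => (y.2, y.1.2) := by fun_prop
  exact (hh.comp (by fun_prop)).mul (h1.comp h2)

lemma measurable_indicator_ringsFirst (hh : Measurable h)
    {f : Finset (Fin n) → Realization n → ℝ≥0∞} (hf : ∀ S, Measurable (f S))
    (S : Finset (Fin n)) (v : Fin n) :
    Measurable ({ω | RingsFirst v ω}.indicator fun ω => h (ω (v, 0)).1 *
      f (absorb S v (ω (v, 0)).2) (residual v (ω (v, 0)).1 ω)) :=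
  ((measurable_mul_absorb hh hf S v).comp (measurable_prodMk_residual v)).indicator
    (measurableSet_ringsFirst v)

lemma measurable_ringFunctional (hh : Measurable h) (c : Finset (Fin n) → ℝ≥0∞) (m : ℕ)
    (S : Finset (Fin n)) : Measurable (ringFunctional h c m S) := by
  induction m generalizing S with
  | zero => exact measurable_const
  | succ m ih =>
    rw [funext fun ω => ringFunctional.eq_2 h c S ω m]
    split_ifs
    · exact measurable_const
    · exact Finset.measurable_sum _ fun v _ => measurable_indicator_ringsFirst hh ih S v

lemma RingsFirst.ringFunctional_succ {v : Fin n} {ω : Realization n} (hv : RingsFirst v ω)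
    (h : ℝ → ℝ≥0∞) (c : Finset (Fin n) → ℝ≥0∞) (m : ℕ) {S : Finset (Fin n)}
    (hS : S ≠ Finset.univ) :
    ringFunctional h c (m + 1) S ω = h (ω (v, 0)).1 *
        ringFunctional h c m (absorb S v (ω (v, 0)).2) (residual v (ω (v, 0)).1 ω) := by
  rw [ringFunctional, if_neg hS, Finset.sum_eq_single v]
  · exact Set.indicator_of_mem (by exact hv) _
  · intro w _ hw
    exact Set.indicator_of_notMem (fun h : RingsFirst w ω => hw (h.unique hv)) _
  · simp

lemma lintegral_ringFunctional_succ (G : SimpleGraph (Fin n)) (hh : Measurable h) (m : ℕ)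
    {S : Finset (Fin n)} (hS : S ≠ Finset.univ) :
    ∫⁻ ω, ringFunctional h c (m + 1) S ω ∂protocolLaw G =
      (∫⁻ x, h x ∂expMeasure n) *
        ringStep G (fun S => ∫⁻ ω, ringFunctional h c m S ω ∂protocolLaw G) S := by
  have hm := measurable_ringFunctional hh c m
  have hterm (v : Fin n) : ∫⁻ ω, {ω | RingsFirst v ω}.indicator (fun ω => h (ω (v, 0)).1 *
        ringFunctional h c m (absorb S v (ω (v, 0)).2) (residual v (ω (v, 0)).1 ω)) ω
          ∂protocolLaw G =
      (n : ℝ≥0∞)⁻¹ * ((∫⁻ x, h x ∂expMeasure n) *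
        ∫⁻ w, ∫⁻ ω, ringFunctional h c m (absorb S v w) ω ∂protocolLaw G ∂contactLaw G v) := by
    have := isProbabilityMeasure_expMeasure (r := n) (by exact_mod_cast v.pos)
    have hg := measurable_mul_absorb hh hm S v
    rw [lintegral_indicator (measurableSet_ringsFirst v),
      ← lintegral_map hg (measurable_prodMk_residual v), map_restrict_ringsFirst,
      lintegral_smul_measure, smul_eq_mul, lintegral_prod _ hg.aemeasurable]
    simp only [lintegral_const_mul _ (hm _)]
    rw [lintegral_prod_mul (f := h)
      (g := fun w => ∫⁻ ω, ringFunctional h c m (absorb S v w) ω ∂protocolLaw G)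
      hh.aemeasurable (measurable_of_countable _).aemeasurable]
  simp only [ringFunctional, if_neg hS]
  rw [lintegral_finsetSum _ fun v _ => measurable_indicator_ringsFirst hh hm S v]
  simp only [hterm, ringStep, ← Finset.mul_sum]
  rw [mul_left_comm]

lemma lintegral_ringFunctional_le (G : SimpleGraph (Fin n)) (hh : Measurable h)
    {b : Finset (Fin n) → ℝ≥0∞} (hcb : ∀ S, S.Nonempty → c S ≤ b S)
    (hb : ∀ S, S.Nonempty → S ≠ Finset.univ → (∫⁻ x, h x ∂expMeasure n) * ringStep G b S ≤ b S)
    (m : ℕ) {S : Finset (Fin n)} (hSne : S.Nonempty) :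
    ∫⁻ ω, ringFunctional h c m S ω ∂protocolLaw G ≤ b S := by
  induction m generalizing S with
  | zero => simpa [ringFunctional] using hcb S hSne
  | succ m ih =>
    by_cases hS : S = Finset.univ
    · simpa [ringFunctional, hS] using hcb Finset.univ (hS ▸ hSne)
    · rw [lintegral_ringFunctional_succ G hh m hS]
      refine le_trans ?_ (hb S hSne hS)
      unfold ringStep
      gcongr with v _ w
      exact ih (hSne.mono (subset_absorb S v w))

end RingFunctional

lemma ae_ringFunctional_eq_pow_or [NeZero n] (G : SimpleGraph (Fin n)) (ρ : ℝ≥0∞) (θ : ℝ)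
    (m : ℕ) :
    ∀ᵐ ω ∂protocolLaw G, ∀ S : Finset (Fin n),
      ringFunctional (fun _ => ρ) (fun S => if S = Finset.univ then 0 else 1) m S ω = ρ ^ m ∨
      ∃ Y : ℝ, IsLeast (coverTimes ω S) Y ∧
        ringFunctional (fun x => ENNReal.ofReal (Real.exp (θ * x)))
          (fun S => if S = Finset.univ then 1 else 0) m S ω =
            ENNReal.ofReal (Real.exp (θ * Y)) := by
  induction m with
  | zero =>
    filter_upwards [ae_positiveWaits G] with ω hω S
    by_cases hS : S = Finset.univ
    · subst hS
      exact .inr ⟨0, isLeast_coverTimes_univ hω, by simp [ringFunctional]⟩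
    · exact .inl (by simp [ringFunctional, hS])
  | succ m ih =>
    filter_upwards [ae_positiveWaits G, ae_exists_ringsFirst G, ae_residual G ih]
      with ω hω ⟨v, hv⟩ hres S
    by_cases hS : S = Finset.univ
    · subst hS
      exact .inr ⟨0, isLeast_coverTimes_univ hω, by simp [ringFunctional]⟩
    · rw [hv.ringFunctional_succ _ _ _ hS, hv.ringFunctional_succ _ _ _ hS]
      rcases hres v hv (absorb S v (ω (v, 0)).2) with h | ⟨Y, hY, hval⟩
      · exact .inl (by rw [h, pow_succ'])
      · refine .inr ⟨(ω (v, 0)).1 + Y, ?_, ?_⟩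
        · rw [hv.coverTimes_eq_image hω hS]
          exact (add_right_mono (a := (ω (v, 0)).1)).map_isLeast hY
        · rw [hval, ← ENNReal.ofReal_mul (Real.exp_pos _).le, ← Real.exp_add, mul_add]

/-- Almost surely finitely many rings inform all nodes: by Markov's inequality, some node is
uninformed after `m` rings with probability `O(ρ⁻ᵐ)`, so the Borel-Cantelli lemma applies. -/
lemma ae_eventually_ringFunctional_lt (G : SimpleGraph (Fin n)) {ρ : ℝ≥0∞} (hρ : 1 < ρ)
    (hρt : ρ ≠ ∞) {b : Finset (Fin n) → ℝ≥0∞} (hb1 : ∀ S, S.Nonempty → 1 ≤ b S)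
    (hb : ∀ S, S.Nonempty → S ≠ Finset.univ → ρ * ringStep G b S ≤ b S)
    {S : Finset (Fin n)} (hS : S.Nonempty) (hbS : b S ≠ ∞) :
    ∀ᵐ ω ∂protocolLaw G, ∀ᶠ m in atTop,
      ringFunctional (fun _ => ρ) (fun S => if S = Finset.univ then 0 else 1) m S ω < ρ ^ m := by
  set Q := fun m => ringFunctional (n := n) (fun _ => ρ)
    (fun S => if S = Finset.univ then 0 else 1) m S
  have : IsProbabilityMeasure (expMeasure n) :=
    isProbabilityMeasure_expMeasure (by exact_mod_cast hS.choose.pos)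
  have hmean (m : ℕ) : ∫⁻ ω, Q m ω ∂protocolLaw G ≤ b S :=
    lintegral_ringFunctional_le G measurable_const
      (fun S hS => by
        split_ifs
        · exact zero_le
        · exact hb1 S hS) (by simpa using hb) m hS
  have htail (m : ℕ) : protocolLaw G {ω | ρ ^ m ≤ Q m ω} ≤ b S * ρ⁻¹ ^ m := by
    have hQm : Measurable (Q m) := measurable_ringFunctional measurable_const _ m _
    refine (meas_ge_le_lintegral_div hQm.aemeasurable
      (pow_ne_zero _ (zero_lt_one.trans hρ).ne') (ENNReal.pow_ne_top hρt)).trans ?_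
    rw [div_eq_mul_inv, ENNReal.inv_pow]
    gcongr
    exact hmean m
  have hsum : ∑' m, protocolLaw G {ω | ρ ^ m ≤ Q m ω} ≠ ∞ := by
    refine ne_top_of_le_ne_top ?_ (ENNReal.tsum_le_tsum htail)
    rw [ENNReal.tsum_mul_left, ENNReal.tsum_geometric]
    exact ENNReal.mul_ne_top hbS
      (ENNReal.inv_ne_top.2 (tsub_pos_of_lt (ENNReal.inv_lt_one.2 hρ)).ne')
  filter_upwards [ae_eventually_notMem hsum] with ω hω
  exact hω.mono fun m hm => not_le.1 hm

lemma ae_eventually_ringFunctional_eq_exp [NeZero n] (G : SimpleGraph (Fin n)) (s : Fin n)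
    {ρ : ℝ≥0∞} (hρ : 1 < ρ) (hρt : ρ ≠ ∞) {b : Finset (Fin n) → ℝ≥0∞}
    (hb1 : ∀ S, S.Nonempty → 1 ≤ b S) (hbs : b {s} ≠ ∞)
    (hb : ∀ S, S.Nonempty → S ≠ Finset.univ → ρ * ringStep G b S ≤ b S) (θ : ℝ) :
    ∀ᵐ ω ∂protocolLaw G, spreadTime s ω ≠ ∞ ∧ ∀ᶠ m in atTop,
      ringFunctional (fun x => ENNReal.ofReal (Real.exp (θ * x)))
          (fun S => if S = Finset.univ then 1 else 0) m {s} ω =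
        ENNReal.ofReal (Real.exp (θ * (spreadTime s ω).toReal)) := by
  filter_upwards [ae_eventually_ringFunctional_lt G hρ hρt hb1 hb
    (Finset.singleton_nonempty s) hbs, ae_positiveWaits G,
    ae_all_iff.2 fun m => ae_ringFunctional_eq_pow_or G ρ θ m] with ω hlt hω hor
  have hcover : ∀ᶠ m in atTop, ∃ Y : ℝ, IsLeast (coverTimes ω {s}) Y ∧
      ringFunctional (fun x => ENNReal.ofReal (Real.exp (θ * x)))
        (fun S => if S = Finset.univ then 1 else 0) m {s} ω = ENNReal.ofReal (Real.exp (θ * Y)) :=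
    hlt.mono fun m hm => (hor m {s}).resolve_left hm.ne
  constructor
  · obtain ⟨m, Y, hY, -⟩ := hcover.exists
    rw [spreadTime_eq_of_isLeast hY]
    exact ENNReal.ofReal_ne_top
  · filter_upwards [hcover] with m ⟨Y, hY, hval⟩
    rw [hval, spreadTime_eq_of_isLeast hY,
      ENNReal.toReal_ofReal (hω.nonneg_of_mem_coverTimes hY.1)]

/-! ### The rate at which the informed set grows -/

/-- The rate at which the set `S` of informed nodes grows: the sum over all nodes of the
probability that the node contacts a node on the other side of the cut. -/
noncomputable def growthRate (G : SimpleGraph (Fin n)) (S : Finset (Fin n)) : ℝ :=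
  ∑ v, (contactLaw G v).real {w | ¬ (v ∈ S ↔ w ∈ S)}

lemma card_absorb (S : Finset (Fin n)) (v w : Fin n) :
    (absorb S v w).card = if (v ∈ S ↔ w ∈ S) then S.card else S.card + 1 := by
  unfold absorb
  by_cases hv : v ∈ S <;> by_cases hw : w ∈ S <;> simp [hv, hw]

lemma lintegral_card_absorb (G : SimpleGraph (Fin n)) (S : Finset (Fin n)) (v : Fin n)
    {b : ℕ → ℝ} (h0 : 0 ≤ b S.card) (h1 : 0 ≤ b (S.card + 1)) :
    ∫⁻ w, ENNReal.ofReal (b (absorb S v w).card) ∂contactLaw G v =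
      ENNReal.ofReal (b S.card + (b (S.card + 1) - b S.card) *
        (contactLaw G v).real {w | ¬ (v ∈ S ↔ w ∈ S)}) := by
  set A := {w | ¬ (v ∈ S ↔ w ∈ S)}
  have hA : MeasurableSet A := A.toFinite.measurableSet
  have hsplit (w : Fin n) : ENNReal.ofReal (b (absorb S v w).card) =
      A.indicator (fun _ => ENNReal.ofReal (b (S.card + 1))) w +
        Aᶜ.indicator (fun _ => ENNReal.ofReal (b S.card)) w := by
    by_cases h : v ∈ S ↔ w ∈ S <;> simp [A, card_absorb, h]
  simp only [hsplit]
  rw [lintegral_add_left (measurable_const.indicator hA), lintegral_indicator_const hA,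
    lintegral_indicator_const hA.compl, ← ofReal_measureReal, ← ofReal_measureReal,
    ← ENNReal.ofReal_mul h1, ← ENNReal.ofReal_mul h0,
    ← ENNReal.ofReal_add (by positivity) (by positivity), probReal_compl_eq_one_sub hA]
  congr 1
  ring

lemma ringStep_card [NeZero n] (G : SimpleGraph (Fin n)) (S : Finset (Fin n)) {b : ℕ → ℝ}
    (h0 : 0 ≤ b S.card) (h1 : 0 ≤ b (S.card + 1)) :
    ringStep G (fun S => ENNReal.ofReal (b S.card)) S =
      ENNReal.ofReal (b S.card + (b (S.card + 1) - b S.card) * (growthRate G S / n)) := by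
  have hn : (0 : ℝ) < n := by exact_mod_cast NeZero.pos n
  have hterm (v : Fin n) : 0 ≤ b S.card + (b (S.card + 1) - b S.card) *
      (contactLaw G v).real {w | ¬ (v ∈ S ↔ w ∈ S)} := by
    set q := (contactLaw G v).real {w | ¬ (v ∈ S ↔ w ∈ S)}
    have hq : q ≤ 1 := measureReal_le_one
    calc 0 ≤ (1 - q) * b S.card + q * b (S.card + 1) :=
          add_nonneg (mul_nonneg (sub_nonneg.2 hq) h0) (mul_nonneg measureReal_nonneg h1)
      _ = b S.card + (b (S.card + 1) - b S.card) * q := by ring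
  simp only [ringStep, lintegral_card_absorb G S _ h0 h1]
  rw [← ENNReal.ofReal_sum_of_nonneg fun v _ => hterm v, ← ENNReal.ofReal_natCast n,
    ← ENNReal.ofReal_inv_of_pos hn, ← ENNReal.ofReal_mul (by positivity)]
  simp only [Finset.sum_add_distrib, ← Finset.mul_sum, Finset.sum_const, Finset.card_univ,
    Fintype.card_fin, nsmul_eq_mul, growthRate]
  congr 1
  field_simp

/-- The product `∏ l j / (l j - θ)` over `k ≤ j < n`: the exponential moment at `θ` of a sum of
independent exponential variables with rates `l j`, that is, of the time a pure birth process with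
these rates takes to get from `k` to `n`. -/
noncomputable def expMoment (n : ℕ) (l : ℕ → ℝ) (θ : ℝ) (k : ℕ) : ℝ :=
  ∏ j ∈ Finset.Ico k n, l j / (l j - θ)

section ExpMoment

variable {l : ℕ → ℝ} {θ : ℝ} {k : ℕ}

lemma expMoment_eq_mul_succ (hk : k < n) :
    expMoment n l θ k = l k / (l k - θ) * expMoment n l θ (k + 1) :=
  Finset.prod_eq_prod_Ico_succ_bot hk _

lemma expMoment_pos (hl : ∀ j ∈ Finset.Ico k n, 0 < l j) (hθ : ∀ j ∈ Finset.Ico k n, θ < l j) :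
    0 < expMoment n l θ k :=
  Finset.prod_pos fun j hj => div_pos (hl j hj) (sub_pos.2 (hθ j hj))

lemma one_le_expMoment (hθ0 : 0 ≤ θ) (hθ : ∀ j ∈ Finset.Ico k n, θ < l j) :
    1 ≤ expMoment n l θ k := by
  refine Finset.one_le_prod fun j hj => ?_
  rw [one_le_div (sub_pos.2 (hθ j hj))]
  exact sub_le_self _ hθ0

/-- The factor `1 - θ / n` is the inverse of the exponential moment at `θ` of the time of the first
ring. -/
lemma ringStep_expMoment_le (G : SimpleGraph (Fin n)) {S : Finset (Fin n)}
    (hS : S ≠ Finset.univ) (hl : ∀ j ∈ Finset.Ico S.card n, 0 < l j)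
    (hθ : ∀ j ∈ Finset.Ico S.card n, θ < l j)
    (hrate : 0 ≤ θ * (growthRate G S - l S.card)) :
    ringStep G (fun S => ENNReal.ofReal (expMoment n l θ S.card)) S ≤
      ENNReal.ofReal ((1 - θ / n) * expMoment n l θ S.card) := by
  have hk : S.card < n := by simpa using (Finset.card_lt_iff_ne_univ S).2 hS
  have : NeZero n := ⟨(Nat.zero_lt_of_lt hk).ne'⟩
  have hn : (0 : ℝ) < n := by exact_mod_cast NeZero.pos n
  have hsub : Finset.Ico (S.card + 1) n ⊆ Finset.Ico S.card n :=
    Finset.Ico_subset_Ico_left (Nat.le_succ _)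
  have hpos' : 0 < expMoment n l θ (S.card + 1) :=
    expMoment_pos (fun j hj => hl j (hsub hj)) fun j hj => hθ j (hsub hj)
  rw [ringStep_card G S (expMoment_pos hl hθ).le hpos'.le]
  refine ENNReal.ofReal_le_ofReal ?_
  set g := growthRate G S
  set β := expMoment n l θ
  have hd : 0 < l S.card - θ := sub_pos.2 (hθ _ (Finset.left_mem_Ico.2 hk))
  set q := β (S.card + 1) / (l S.card - θ)
  have : 0 ≤ q := by positivity
  have hβ : β S.card = l S.card * q := by
    simp only [q, β]
    rw [expMoment_eq_mul_succ hk]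
    ring
  have hβ' : β (S.card + 1) = (l S.card - θ) * q := by
    simp only [q]
    field_simp
  rw [← sub_nonneg]
  calc (0 : ℝ) ≤ θ * (g - l S.card) * q / n := by positivity
    _ = (1 - θ / n) * β S.card - (β S.card + (β (S.card + 1) - β S.card) * (g / n)) := by
      rw [hβ, hβ']
      ring

end ExpMoment

/-! ### Exponential moments of the spreading time -/

lemma ofReal_mul_ringStep_expMoment_le (G : SimpleGraph (Fin n)) {l : ℕ → ℝ} {θ : ℝ}
    (hθn : θ < n) {S : Finset (Fin n)} (hS : S ≠ Finset.univ)
    (hl : ∀ j ∈ Finset.Ico S.card n, 0 < l j) (hθ : ∀ j ∈ Finset.Ico S.card n, θ < l j)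
    (hrate : 0 ≤ θ * (growthRate G S - l S.card)) :
    ENNReal.ofReal (n / (n - θ)) *
        ringStep G (fun S => ENNReal.ofReal (expMoment n l θ S.card)) S ≤
      ENNReal.ofReal (expMoment n l θ S.card) := by
  have hk : S.card < n := by simpa using (Finset.card_lt_iff_ne_univ S).2 hS
  have hn : (0 : ℝ) < n := by exact_mod_cast Nat.zero_lt_of_lt hk
  have hd : 0 < n - θ := sub_pos.2 hθn
  grw [ringStep_expMoment_le G hS hl hθ hrate, ← ENNReal.ofReal_mul (by positivity)]
  refine le_of_eq (congrArg _ ?_)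
  field_simp

section PositiveGrowth

variable {G : SimpleGraph (Fin n)}

/-- By comparison with a pure birth process with constant rate. -/
lemma ae_eventually_ringFunctional_eq_exp_of_growthRate_pos
    (hG : ∀ S : Finset (Fin n), S.Nonempty → S ≠ Finset.univ → 0 < growthRate G S)
    (s : Fin n) (θ : ℝ) :
    ∀ᵐ ω ∂protocolLaw G, spreadTime s ω ≠ ∞ ∧ ∀ᶠ m in atTop,
      ringFunctional (fun x => ENNReal.ofReal (Real.exp (θ * x)))
          (fun S => if S = Finset.univ then 1 else 0) m {s} ω =
        ENNReal.ofReal (Real.exp (θ * (spreadTime s ω).toReal)) := by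
  have : NeZero n := ⟨s.pos.ne'⟩
  have hn : (0 : ℝ) < n := by exact_mod_cast s.pos
  obtain ⟨c, hc, hcn, hcG⟩ : ∃ c : ℝ, 0 < c ∧ c < n ∧ ∀ S : Finset (Fin n), S.Nonempty →
      S ≠ Finset.univ → c < growthRate G S := by
    have hsmall : ∀ᶠ c : ℝ in 𝓝[>] 0, c < n ∧ ∀ S : Finset (Fin n), S.Nonempty →
        S ≠ Finset.univ → c < growthRate G S := by
      refine nhdsWithin_le_nhds ((eventually_lt_nhds hn).and (eventually_all.2 fun S => ?_))
      by_cases hS : S.Nonempty ∧ S ≠ Finset.univ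
      · filter_upwards [eventually_lt_nhds (hG S hS.1 hS.2)] with c hc _ _ using hc
      · exact Eventually.of_forall fun c h h' => (hS ⟨h, h'⟩).elim
    obtain ⟨c, hc, hc0⟩ := (hsmall.and self_mem_nhdsWithin).exists
    exact ⟨c, hc0, hc⟩
  have hd : 0 < n - c / 2 := by linarith
  refine ae_eventually_ringFunctional_eq_exp G s (ρ := ENNReal.ofReal (n / (n - c / 2)))
    (b := fun S => ENNReal.ofReal (expMoment n (fun _ => c) (c / 2) S.card)) ?_
    ENNReal.ofReal_ne_top (fun S _ => ?_) ENNReal.ofReal_ne_top (fun S hS hS' => ?_) θ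
  · rw [ENNReal.one_lt_ofReal, one_lt_div hd]
    linarith
  · rw [ENNReal.one_le_ofReal]
    exact one_le_expMoment (by positivity) fun _ _ => half_lt_self hc
  · exact ofReal_mul_ringStep_expMoment_le G (by linarith) hS' (fun _ _ => hc)
      (fun _ _ => half_lt_self hc) (mul_nonneg (by positivity) (sub_nonneg.2 (hcG S hS hS').le))

variable (hG : ∀ S : Finset (Fin n), S.Nonempty → S ≠ Finset.univ → 0 < growthRate G S)
  (s : Fin n)

include hG

lemma ae_spreadTime_ne_top : ∀ᵐ ω ∂protocolLaw G, spreadTime s ω ≠ ∞ :=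
  (ae_eventually_ringFunctional_eq_exp_of_growthRate_pos hG s 0).mono fun _ h => h.1

lemma aemeasurable_toReal_spreadTime :
    AEMeasurable (fun ω => (spreadTime s ω).toReal) (protocolLaw G) := by
  have hexp : AEMeasurable (fun ω => ENNReal.ofReal (Real.exp (1 * (spreadTime s ω).toReal)))
      (protocolLaw G) :=
    aemeasurable_of_tendsto_metrizable_ae atTop
      (fun m => (measurable_ringFunctional (by fun_prop) _ m _).aemeasurable)
      ((ae_eventually_ringFunctional_eq_exp_of_growthRate_pos hG s 1).mono fun ω h =>
        tendsto_nhds_of_eventually_eq h.2)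
  refine ((Real.measurable_log.comp ENNReal.measurable_toReal).comp_aemeasurable hexp).congr
    (ae_of_all _ fun ω => ?_)
  simp [ENNReal.toReal_ofReal (Real.exp_pos _).le]

variable {l : ℕ → ℝ} {θ : ℝ} (hθn : θ < n) (hl : ∀ k ∈ Finset.Ico 1 n, 0 < l k)
  (hθ : ∀ k ∈ Finset.Ico 1 n, θ < l k)
  (hrate : ∀ S : Finset (Fin n), S.Nonempty → S ≠ Finset.univ →
    0 ≤ θ * (growthRate G S - l S.card))

include hθn hl hθ hrate

lemma lintegral_exp_spreadTime_le :
    ∫⁻ ω, ENNReal.ofReal (Real.exp (θ * (spreadTime s ω).toReal)) ∂protocolLaw G ≤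
      ENNReal.ofReal (expMoment n l θ 1) := by
  have hn : (0 : ℝ) < n := by exact_mod_cast s.pos
  have hfunctional (m : ℕ) : ∫⁻ ω, ringFunctional (fun x => ENNReal.ofReal (Real.exp (θ * x)))
      (fun S => if S = Finset.univ then 1 else 0) m {s} ω ∂protocolLaw G ≤
        ENNReal.ofReal (expMoment n l θ 1) := by
    refine lintegral_ringFunctional_le G (by fun_prop)
      (b := fun S => ENNReal.ofReal (expMoment n l θ S.card)) (fun S _ => ?_)
      (fun S hS hS' => ?_) m (Finset.singleton_nonempty s)
    · split_ifs with h
      · simp [h, expMoment]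
      · exact zero_le
    · have hsub : Finset.Ico S.card n ⊆ Finset.Ico 1 n :=
        Finset.Ico_subset_Ico_left hS.card_pos
      rw [lintegral_exp_mul_expMeasure hn hθn]
      exact ofReal_mul_ringStep_expMoment_le G hθn hS' (fun j hj => hl j (hsub hj))
        (fun j hj => hθ j (hsub hj)) (hrate S hS hS')
  rw [lintegral_congr_ae ((ae_eventually_ringFunctional_eq_exp_of_growthRate_pos hG s θ).mono
    fun ω h => (tendsto_nhds_of_eventually_eq h.2).liminf_eq.symm)]
  refine (lintegral_liminf_le fun m => measurable_ringFunctional (by fun_prop) _ m _).trans ?_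
  exact liminf_le_of_frequently_le' (Frequently.of_forall hfunctional)

lemma integrable_exp_spreadTime :
    Integrable (fun ω => Real.exp (θ * (spreadTime s ω).toReal)) (protocolLaw G) := by
  have hmeas := (aemeasurable_toReal_spreadTime hG s).const_mul θ
  refine ⟨(Real.measurable_exp.comp_aemeasurable hmeas).aestronglyMeasurable, ?_⟩
  rw [hasFiniteIntegral_iff_ofReal (ae_of_all _ fun ω => (Real.exp_pos _).le)]
  exact (lintegral_exp_spreadTime_le hG s hθn hl hθ hrate).trans_lt ENNReal.ofReal_lt_top

lemma mgf_spreadTime_le :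
    mgf (fun ω => (spreadTime s ω).toReal) (protocolLaw G) θ ≤ expMoment n l θ 1 := by
  have hint := integrable_exp_spreadTime hG s hθn hl hθ hrate
  rw [← ENNReal.ofReal_le_ofReal_iff (expMoment_pos hl hθ).le, mgf,
    ofReal_integral_eq_lintegral_ofReal hint (ae_of_all _ fun ω => (Real.exp_pos _).le)]
  exact lintegral_exp_spreadTime_le hG s hθn hl hθ hrate

end PositiveGrowth

/-! ### Growth rates in graphs with uniform cuts -/

/-- The rate at which a set of `k` informed nodes grows in the complete graph on `n` nodes. -/
noncomputable def completeRate (n k : ℕ) : ℝ := 2 * k * (n - k) / (n - 1)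

section Degree

variable (G : SimpleGraph (Fin n)) [DecidableRel G.Adj]

lemma contactLaw_real {v : Fin n} (hv : 0 < G.degree v) (A : Set (Fin n)) [DecidablePred (· ∈ A)] :
    (contactLaw G v).real A = (Finset.card {w | G.Adj v w ∧ w ∈ A} : ℝ) / G.degree v := by
  have hne : (G.neighborSet v).Nonempty := by
    simpa [Set.Nonempty] using (G.degree_pos_iff_exists_adj v).1 hv
  have hdeg : Measure.count (G.neighborSet v) = (G.degree v : ℝ≥0∞) := by
    rw [← G.card_neighborFinset_eq_degree, ← Measure.count_apply_finset, G.coe_neighborFinset]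
  have hinter : Measure.count (G.neighborSet v ∩ A) =
      (Finset.card {w | G.Adj v w ∧ w ∈ A} : ℝ≥0∞) := by
    rw [← Measure.count_apply_finset]
    congr 1
    ext w
    simp
  rw [contactLaw, if_pos hne, measureReal_def, uniformOn,
    cond_apply (Set.toFinite _).measurableSet, hdeg, hinter]
  simp [div_eq_inv_mul]

lemma sum_card_filter_adj (A B : Finset (Fin n)) :
    ∑ v ∈ A, Finset.card {w | G.Adj v w ∧ w ∈ B} = (G.interedges A B).card := by
  rw [SimpleGraph.interedges, Rel.interedges, Finset.card_filter, Finset.sum_product]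
  refine Finset.sum_congr rfl fun v _ => ?_
  rw [← Finset.card_filter]
  congr 1
  ext w
  simp [and_comm]

lemma degree_eq_card_interedges (v : Fin n) : G.degree v = (G.interedges {v} {v}ᶜ).card := by
  rw [← sum_card_filter_adj, Finset.sum_singleton, ← G.card_neighborFinset_eq_degree]
  congr 1
  ext w
  simpa using fun h => h.ne'

lemma sum_card_filter_adj_cut (S : Finset (Fin n)) :
    ∑ v, Finset.card {w | G.Adj v w ∧ ¬ (v ∈ S ↔ w ∈ S)} = 2 * (G.interedges S Sᶜ).card := by
  have := G.symm
  have hcomm : (G.interedges Sᶜ S).card = (G.interedges S Sᶜ).card := Rel.card_interedges_comm Sᶜ S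
  rw [← Finset.sum_add_sum_compl S, two_mul]
  nth_rw 2 [← hcomm]
  rw [← sum_card_filter_adj, ← sum_card_filter_adj]
  congr 1 <;> refine Finset.sum_congr rfl fun v hv => ?_
  · simp [hv]
  · simp [Finset.mem_compl.1 hv]

variable {G}

lemma growthRate_eq_sum_div_degree (hG : ∀ v, 0 < G.degree v) (S : Finset (Fin n)) :
    growthRate G S =
      ∑ v, (Finset.card {w | G.Adj v w ∧ ¬ (v ∈ S ↔ w ∈ S)} : ℝ) / G.degree v := by
  refine Finset.sum_congr rfl fun v _ => ?_
  rw [contactLaw_real G (hG v)]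
  simp

lemma growthRate_le_of_le_degree {d : ℝ} (hd : 0 < d) (hG : ∀ v, d ≤ G.degree v)
    (S : Finset (Fin n)) : growthRate G S ≤ 2 * (G.interedges S Sᶜ).card / d := by
  have hpos (v : Fin n) : 0 < G.degree v := by exact_mod_cast hd.trans_le (hG v)
  rw [growthRate_eq_sum_div_degree hpos, ← Nat.cast_ofNat, ← Nat.cast_mul,
    ← sum_card_filter_adj_cut, Nat.cast_sum, Finset.sum_div]
  gcongr with v
  exact hG v

lemma le_growthRate_of_degree_le {d : ℝ} (hpos : ∀ v, 0 < G.degree v) (hG : ∀ v, G.degree v ≤ d)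
    (S : Finset (Fin n)) : 2 * (G.interedges S Sᶜ).card / d ≤ growthRate G S := by
  rw [growthRate_eq_sum_div_degree hpos, ← Nat.cast_ofNat, ← Nat.cast_mul,
    ← sum_card_filter_adj_cut, Nat.cast_sum, Finset.sum_div]
  gcongr with v
  · exact_mod_cast hpos v
  · exact hG v

lemma UniformCuts.card_interedges_mem {a : ℝ} (h : UniformCuts G a) (S : Finset (Fin n)) :
    ((G.interedges S Sᶜ).card : ℝ) ∈ Set.Icc
      ((1 - √(8 / a)) * (a * Real.log n / n * S.card * (n - S.card)))
      ((1 + √(8 / a)) * (a * Real.log n / n * S.card * (n - S.card))) := by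
  have hS : |((G.interedges S Sᶜ).card : ℝ) - a * Real.log n / n * S.card * (n - S.card)| ≤
      √(8 / a) * (a * Real.log n / n * S.card * (n - S.card)) := by
    convert h S
  rw [abs_le] at hS
  constructor <;> linarith [hS.1, hS.2]

lemma UniformCuts.degree_mem {a : ℝ} (h : UniformCuts G a) (v : Fin n) :
    (G.degree v : ℝ) ∈ Set.Icc ((1 - √(8 / a)) * (a * Real.log n / n * (n - 1)))
      ((1 + √(8 / a)) * (a * Real.log n / n * (n - 1))) := by
  rw [degree_eq_card_interedges]
  simpa using h.card_interedges_mem {v}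

end Degree

section UniformCuts

variable {G : SimpleGraph (Fin n)} {a : ℝ}

lemma UniformCuts.mul_completeRate_le_growthRate (h : UniformCuts G a) (ha : 0 < a)
    (hε : √(8 / a) < 1) (hn : 2 ≤ n) (S : Finset (Fin n)) :
    (1 - √(8 / a)) / (1 + √(8 / a)) * completeRate n S.card ≤ growthRate G S := by
  classical
  have hn1 : (0 : ℝ) < n - 1 := sub_pos.2 (by exact_mod_cast hn)
  have hlog : 0 < Real.log n := Real.log_pos (by exact_mod_cast hn)
  have hcut := (h.card_interedges_mem S).1
  have hdeg := h.degree_mem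
  set ε := √(8 / a)
  set q := a * Real.log n / n
  have hq : 0 < q := by positivity
  have hlow : 0 < (1 - ε) * (q * (n - 1)) := mul_pos (sub_pos.2 hε) (by positivity)
  calc (1 - ε) / (1 + ε) * completeRate n S.card
      = 2 * ((1 - ε) * (q * S.card * (n - S.card))) / ((1 + ε) * (q * (n - 1))) := by
        rw [completeRate]
        field_simp
    _ ≤ 2 * (G.interedges S Sᶜ).card / ((1 + ε) * (q * (n - 1))) := by gcongr
    _ ≤ growthRate G S := le_growthRate_of_degree_le
        (fun v => by exact_mod_cast hlow.trans_le (hdeg v).1) (fun v => (hdeg v).2) S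

lemma UniformCuts.growthRate_le_mul_completeRate (h : UniformCuts G a) (ha : 0 < a)
    (hε : √(8 / a) < 1) (hn : 2 ≤ n) (S : Finset (Fin n)) :
    growthRate G S ≤ (1 + √(8 / a)) / (1 - √(8 / a)) * completeRate n S.card := by
  classical
  have hn1 : (0 : ℝ) < n - 1 := sub_pos.2 (by exact_mod_cast hn)
  have hlog : 0 < Real.log n := Real.log_pos (by exact_mod_cast hn)
  have hcut := (h.card_interedges_mem S).2
  have hdeg := h.degree_mem
  set ε := √(8 / a)
  set q := a * Real.log n / n
  have hq : 0 < q := by positivity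
  have hε' : 0 < 1 - ε := sub_pos.2 hε
  calc growthRate G S ≤ 2 * (G.interedges S Sᶜ).card / ((1 - ε) * (q * (n - 1))) :=
        growthRate_le_of_le_degree (by positivity) (fun v => (hdeg v).1) S
    _ ≤ 2 * ((1 + ε) * (q * S.card * (n - S.card))) / ((1 - ε) * (q * (n - 1))) := by gcongr
    _ = (1 + ε) / (1 - ε) * completeRate n S.card := by
        rw [completeRate]
        field_simp

end UniformCuts

/-! ### Exponential moments in the complete graph -/

lemma inv_one_sub_le_exp {x : ℝ} (hx : |x| ≤ 1 / 2) : (1 - x)⁻¹ ≤ Real.exp (x + 2 * x ^ 2) := by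
  have hpos : 0 < 1 - x := by linarith [(abs_le.1 hx).2]
  have htaylor : |x + Real.log (1 - x)| ≤ x ^ 2 / (1 - |x|) := by
    simpa using Real.abs_log_sub_add_sum_range_le (hx.trans_lt one_half_lt_one) 1
  have hrem : x ^ 2 / (1 - |x|) ≤ 2 * x ^ 2 := by
    rw [div_le_iff₀ (by linarith)]
    nlinarith [sq_nonneg x]
  rw [← Real.log_le_iff_le_exp (inv_pos.2 hpos), Real.log_inv]
  linarith [(abs_le.1 htaylor).1]

lemma expMoment_le_exp {l : ℕ → ℝ} {θ : ℝ} {k : ℕ} (hl : ∀ j ∈ Finset.Ico k n, 0 < l j)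
    (hθ : ∀ j ∈ Finset.Ico k n, |θ| ≤ l j / 2) :
    expMoment n l θ k ≤ Real.exp (θ * ∑ j ∈ Finset.Ico k n, (l j)⁻¹ +
      2 * θ ^ 2 * ∑ j ∈ Finset.Ico k n, ((l j)⁻¹) ^ 2) := by
  rw [Finset.mul_sum, Finset.mul_sum, ← Finset.sum_add_distrib, Real.exp_sum]
  refine Finset.prod_le_prod (fun j hj => ?_) fun j hj => ?_ <;> have hj0 := hl j hj
  · exact div_nonneg hj0.le (by linarith [le_abs_self θ, hθ j hj])
  · have hx : |θ / l j| ≤ 1 / 2 := by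
      rw [abs_div, abs_of_pos hj0, div_le_iff₀ hj0]
      linarith [hθ j hj]
    calc l j / (l j - θ) = (1 - θ / l j)⁻¹ := by field_simp
      _ ≤ Real.exp (θ / l j + 2 * (θ / l j) ^ 2) := inv_one_sub_le_exp hx
      _ = Real.exp (θ * (l j)⁻¹ + 2 * θ ^ 2 * ((l j)⁻¹) ^ 2) := by ring_nf

/-- The expectation of the time a pure birth process with the rates of the complete graph takes to
get from `1` to `n`. -/
noncomputable def completeMean (n : ℕ) : ℝ := ∑ k ∈ Finset.Ico 1 n, (completeRate n k)⁻¹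

lemma inv_completeRate {k : ℕ} (hk : k ∈ Finset.Ico 1 n) :
    (completeRate n k)⁻¹ = (n - 1) / (2 * n) * ((k : ℝ)⁻¹ + ((n - k : ℕ) : ℝ)⁻¹) := by
  rw [Finset.mem_Ico] at hk
  have hk0 : (0 : ℝ) < k := by exact_mod_cast hk.1
  have hkn : (0 : ℝ) < n - k := sub_pos.2 (by exact_mod_cast hk.2)
  have hn : (0 : ℝ) < n := by linarith
  rw [completeRate, Nat.cast_sub hk.2.le]
  field_simp
  ring

lemma sum_Ico_one_reflect (f : ℕ → ℝ) :
    ∑ k ∈ Finset.Ico 1 n, f (n - k) = ∑ k ∈ Finset.Ico 1 n, f k := by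
  simpa using Finset.sum_Ico_reflect f 1 n.le_succ

lemma completeMean_eq (n : ℕ) : completeMean n = (n - 1) / n * (harmonic (n - 1) : ℝ) := by
  have hharm : (harmonic (n - 1) : ℝ) = ∑ k ∈ Finset.Ico 1 n, (k : ℝ)⁻¹ := by
    have hIcc : Finset.Icc 1 (n - 1) = Finset.Ico 1 n := by
      ext k
      simp only [Finset.mem_Icc, Finset.mem_Ico]
      lia
    rw [harmonic_eq_sum_Icc, hIcc]
    push_cast
    rfl
  rw [completeMean, Finset.sum_congr rfl fun k hk => inv_completeRate hk, ← Finset.mul_sum,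
    Finset.sum_add_distrib, sum_Ico_one_reflect fun k => (k : ℝ)⁻¹, hharm]
  ring

lemma one_le_completeRate {k : ℕ} (hk : k ∈ Finset.Ico 1 n) : 1 ≤ completeRate n k := by
  rw [Finset.mem_Ico] at hk
  have h1 : (1 : ℝ) ≤ k := by exact_mod_cast hk.1
  have h2 : (k : ℝ) + 1 ≤ n := by exact_mod_cast hk.2
  rw [completeRate, le_div_iff₀ (by linarith)]
  nlinarith [mul_nonneg (sub_nonneg.2 h1) (by linarith : (0 : ℝ) ≤ n - k - 1)]

lemma sum_inv_completeRate_sq_le (n : ℕ) :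
    ∑ k ∈ Finset.Ico 1 n, ((completeRate n k)⁻¹) ^ 2 ≤ 4 := by
  have hterm : ∀ k ∈ Finset.Ico 1 n, ((completeRate n k)⁻¹) ^ 2 ≤
      ((k : ℝ) ^ 2)⁻¹ + (((n - k : ℕ) : ℝ) ^ 2)⁻¹ := by
    intro k hk
    have hn : (1 : ℝ) ≤ n := by
      have := Finset.mem_Ico.1 hk
      exact_mod_cast this.1.trans this.2.le
    have hc : ((n : ℝ) - 1) / (2 * n) ≤ 1 / 2 := by
      rw [div_le_div_iff₀ (by linarith) two_pos]
      linarith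
    have : 0 ≤ ((n : ℝ) - 1) / (2 * n) := div_nonneg (by linarith) (by linarith)
    rw [inv_completeRate hk, mul_pow, ← inv_pow, ← inv_pow]
    calc _ ≤ (1 / 2 : ℝ) ^ 2 * ((k : ℝ)⁻¹ + ((n - k : ℕ) : ℝ)⁻¹) ^ 2 := by gcongr
      _ ≤ (1 / 2 : ℝ) ^ 2 * (2 * ((k : ℝ)⁻¹ ^ 2 + ((n - k : ℕ) : ℝ)⁻¹ ^ 2)) := by
        gcongr
        exact add_sq_le
      _ ≤ (k : ℝ)⁻¹ ^ 2 + ((n - k : ℕ) : ℝ)⁻¹ ^ 2 := by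
        linarith [sq_nonneg (k : ℝ)⁻¹, sq_nonneg ((n - k : ℕ) : ℝ)⁻¹]
  refine (Finset.sum_le_sum hterm).trans ?_
  rw [Finset.sum_add_distrib, sum_Ico_one_reflect fun k => ((k : ℝ) ^ 2)⁻¹]
  have hsq : ∑ k ∈ Finset.Ico 1 n, ((k : ℝ) ^ 2)⁻¹ ≤ 2 := by
    have hIoo := sum_Ioo_inv_sq_le (α := ℝ) 0 n
    simpa [← Finset.Ico_add_one_left_eq_Ioo] using hIoo
  linarith

/-! ### Mean and tails from exponential moments -/

section Probability

variable {Ω : Type*} [MeasurableSpace Ω] {μ : Measure Ω} [IsProbabilityMeasure μ] {X : Ω → ℝ}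

lemma exp_mul_integral_le_mgf {θ : ℝ} (hX : Integrable X μ)
    (hexp : Integrable (fun ω => Real.exp (θ * X ω)) μ) :
    Real.exp (θ * ∫ ω, X ω ∂μ) ≤ mgf X μ θ := by
  rw [← integral_const_mul]
  exact convexOn_exp.map_integral_le Real.continuous_exp.continuousOn isClosed_univ
    (ae_of_all _ fun _ => Set.mem_univ _) (hX.const_mul θ) hexp

lemma integral_le_of_mgf_le_exp {A K θ₀ : ℝ} (hX : Integrable X μ) (hθ₀ : 0 < θ₀)
    (h : ∀ θ ∈ Set.Ioc 0 θ₀, Integrable (fun ω => Real.exp (θ * X ω)) μ ∧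
      mgf X μ θ ≤ Real.exp (θ * A + K * θ ^ 2)) :
    ∫ ω, X ω ∂μ ≤ A := by
  have hlim : Tendsto (fun θ => A + K * θ) (𝓝[>] 0) (𝓝 A) := by
    have hcont : Continuous fun θ => A + K * θ := by fun_prop
    simpa using (hcont.tendsto 0).mono_left nhdsWithin_le_nhds
  refine ge_of_tendsto hlim ?_
  filter_upwards [Ioc_mem_nhdsGT hθ₀] with θ hθ
  have hle := Real.exp_le_exp.1 ((exp_mul_integral_le_mgf hX (h θ hθ).1).trans (h θ hθ).2)
  refine le_of_mul_le_mul_left (hle.trans_eq ?_) hθ.1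
  ring

end Probability

/-! ### Mean and tails of the spreading time -/

lemma card_mem_Ico_one {S : Finset (Fin n)} (hS : S.Nonempty) (hS' : S ≠ Finset.univ) :
    S.card ∈ Finset.Ico 1 n :=
  Finset.mem_Ico.2 ⟨hS.card_pos, by simpa using (Finset.card_lt_iff_ne_univ S).2 hS'⟩

section GrowthRate

variable {G : SimpleGraph (Fin n)} {r : ℝ}

lemma growthRate_pos_of_mul_completeRate_le (hr : 0 < r)
    (hlow : ∀ S, r * completeRate n S.card ≤ growthRate G S) {S : Finset (Fin n)}
    (hS : S.Nonempty) (hS' : S ≠ Finset.univ) : 0 < growthRate G S :=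
  (mul_pos hr (one_pos.trans_le (one_le_completeRate (card_mem_Ico_one hS hS')))).trans_le (hlow S)

lemma exp_moment_spreadTime_of_growthRate
    (hG : ∀ S : Finset (Fin n), S.Nonempty → S ≠ Finset.univ → 0 < growthRate G S)
    (s : Fin n) {c θ : ℝ} (hc : 1 / 2 ≤ c) (hθ : |θ| ≤ 1 / 4)
    (hrate : ∀ S, 0 ≤ θ * (growthRate G S - c * completeRate n S.card)) :
    Integrable (fun ω => Real.exp (θ * (spreadTime s ω).toReal)) (protocolLaw G) ∧
    mgf (fun ω => (spreadTime s ω).toReal) (protocolLaw G) θ ≤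
      Real.exp (θ * (c⁻¹ * completeMean n) + 32 * θ ^ 2) := by
  have hn : (1 : ℝ) ≤ n := by exact_mod_cast s.pos
  have hθ' := (abs_le.1 hθ).2
  have hl : ∀ k ∈ Finset.Ico 1 n, 1 / 2 ≤ c * completeRate n k := fun k hk =>
    hc.trans (le_mul_of_one_le_right (by linarith) (one_le_completeRate hk))
  have hl0 : ∀ k ∈ Finset.Ico 1 n, 0 < c * completeRate n k := fun k hk =>
    one_half_pos.trans_le (hl k hk)
  have hlθ : ∀ k ∈ Finset.Ico 1 n, θ < c * completeRate n k := fun k hk => by linarith [hl k hk]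
  refine ⟨integrable_exp_spreadTime hG s (by linarith) hl0 hlθ fun S _ _ => hrate S,
    (mgf_spreadTime_le hG s (by linarith) hl0 hlθ fun S _ _ => hrate S).trans
      ((expMoment_le_exp hl0 fun k hk => by linarith [hl k hk]).trans (Real.exp_le_exp.2 ?_))⟩
  have hc2 : c⁻¹ ≤ 2 := inv_le_of_inv_le₀ two_pos (by linarith)
  have : 0 ≤ c⁻¹ := inv_nonneg.2 (by linarith)
  simp only [mul_inv, mul_pow, ← Finset.mul_sum]
  rw [← completeMean]
  have hsq : c⁻¹ ^ 2 * ∑ k ∈ Finset.Ico 1 n, (completeRate n k)⁻¹ ^ 2 ≤ 2 ^ 2 * 4 := by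
    gcongr
    exact sum_inv_completeRate_sq_le n
  linarith [mul_le_mul_of_nonneg_left hsq (by positivity : 0 ≤ 2 * θ ^ 2)]

variable (hr : 1 / 2 ≤ r) (hr1 : r ≤ 1)
  (hlow : ∀ S, r * completeRate n S.card ≤ growthRate G S)
  (hupp : ∀ S, growthRate G S ≤ r⁻¹ * completeRate n S.card) (s : Fin n)

include hr hlow

lemma exp_moment_spreadTime_of_nonneg {θ : ℝ} (hθ0 : 0 ≤ θ) (hθ : θ ≤ 1 / 4) :
    Integrable (fun ω => Real.exp (θ * (spreadTime s ω).toReal)) (protocolLaw G) ∧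
    mgf (fun ω => (spreadTime s ω).toReal) (protocolLaw G) θ ≤
      Real.exp (θ * (r⁻¹ * completeMean n) + 32 * θ ^ 2) :=
  exp_moment_spreadTime_of_growthRate
    (fun _ => growthRate_pos_of_mul_completeRate_le (by linarith) hlow) s hr
    (by rwa [abs_of_nonneg hθ0]) fun S => mul_nonneg hθ0 (sub_nonneg.2 (hlow S))

lemma measureReal_spreadTime_ge_le (x : ℝ) :
    (protocolLaw G).real {ω | r⁻¹ * completeMean n + x ≤ (spreadTime s ω).toReal} ≤
      Real.exp (2 - x / 4) := by
  have hexp := exp_moment_spreadTime_of_nonneg hr hlow s (θ := 1 / 4) (by norm_num) le_rfl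
  refine (measure_ge_le_exp_mul_mgf _ (by norm_num) hexp.1).trans
    ((mul_le_mul_of_nonneg_left hexp.2 (Real.exp_pos _).le).trans_eq ?_)
  rw [← Real.exp_add]
  ring_nf

include hr1 hupp

lemma exp_moment_spreadTime_of_nonpos {θ : ℝ} (hθ0 : θ ≤ 0) (hθ : -(1 / 4) ≤ θ) :
    Integrable (fun ω => Real.exp (θ * (spreadTime s ω).toReal)) (protocolLaw G) ∧
    mgf (fun ω => (spreadTime s ω).toReal) (protocolLaw G) θ ≤
      Real.exp (θ * (r * completeMean n) + 32 * θ ^ 2) := by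
  have hr0 : 0 < r := by linarith
  have hrinv : 1 / 2 ≤ r⁻¹ := by linarith [(one_le_inv₀ hr0).2 hr1]
  simpa using exp_moment_spreadTime_of_growthRate
    (fun _ => growthRate_pos_of_mul_completeRate_le hr0 hlow) s hrinv
    (abs_le.2 ⟨hθ, by linarith⟩)
    fun S => mul_nonneg_of_nonpos_of_nonpos hθ0 (sub_nonpos.2 (hupp S))

lemma integrable_spreadTime :
    Integrable (fun ω => (spreadTime s ω).toReal) (protocolLaw G) := by
  have hpos := exp_moment_spreadTime_of_nonneg hr hlow s (θ := 1 / 4) (by norm_num) le_rfl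
  have hneg := exp_moment_spreadTime_of_nonpos hr hr1 hlow hupp s (θ := -(1 / 4)) (by norm_num)
    le_rfl
  simpa using integrable_pow_of_integrable_exp_mul (by norm_num) hpos.1 hneg.1 1

lemma meanSpreadTime_eq_ofReal_integral :
    meanSpreadTime G s = ENNReal.ofReal (∫ ω, (spreadTime s ω).toReal ∂protocolLaw G) := by
  rw [ofReal_integral_eq_lintegral_ofReal (integrable_spreadTime hr hr1 hlow hupp s)
    (ae_of_all _ fun ω => ENNReal.toReal_nonneg)]
  have hfin := ae_spreadTime_ne_top
    (fun _ => growthRate_pos_of_mul_completeRate_le (by linarith) hlow) s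
  exact lintegral_congr_ae (hfin.mono fun ω hω => (ENNReal.ofReal_toReal hω).symm)

lemma toReal_meanSpreadTime :
    (meanSpreadTime G s).toReal = ∫ ω, (spreadTime s ω).toReal ∂protocolLaw G := by
  rw [meanSpreadTime_eq_ofReal_integral hr hr1 hlow hupp s,
    ENNReal.toReal_ofReal (integral_nonneg fun ω => ENNReal.toReal_nonneg)]

lemma toReal_meanSpreadTime_le : (meanSpreadTime G s).toReal ≤ r⁻¹ * completeMean n := by
  rw [toReal_meanSpreadTime hr hr1 hlow hupp s]
  exact integral_le_of_mgf_le_exp (integrable_spreadTime hr hr1 hlow hupp s)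
    (by norm_num : (0 : ℝ) < 1 / 4)
    fun θ hθ => exp_moment_spreadTime_of_nonneg hr hlow s hθ.1.le hθ.2

lemma le_toReal_meanSpreadTime : r * completeMean n ≤ (meanSpreadTime G s).toReal := by
  rw [toReal_meanSpreadTime hr hr1 hlow hupp s, ← neg_le_neg_iff, ← integral_neg]
  refine integral_le_of_mgf_le_exp (integrable_spreadTime hr hr1 hlow hupp s).neg
    (K := 32) (by norm_num : (0 : ℝ) < 1 / 4) fun θ hθ => ?_
  have hneg := exp_moment_spreadTime_of_nonpos hr hr1 hlow hupp s (neg_nonpos.2 hθ.1.le)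
    (neg_le_neg hθ.2)
  refine ⟨by simpa using hneg.1, mgf_neg.trans_le (hneg.2.trans_eq ?_)⟩
  ring_nf

lemma measureReal_spreadTime_le_le (x : ℝ) :
    (protocolLaw G).real {ω | (spreadTime s ω).toReal ≤ r * completeMean n - x} ≤
      Real.exp (2 - x / 4) := by
  have hexp := exp_moment_spreadTime_of_nonpos hr hr1 hlow hupp s (θ := -(1 / 4)) (by norm_num)
    le_rfl
  refine (measure_le_le_exp_mul_mgf _ (by norm_num) hexp.1).trans
    ((mul_le_mul_of_nonneg_left hexp.2 (Real.exp_pos _).le).trans_eq ?_)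
  rw [← Real.exp_add]
  ring_nf

lemma protocolLaw_compl_concentrationEvent_le (x : ℝ) :
    protocolLaw G (concentrationEvent ((r⁻¹ - r) * completeMean n + x) G s)ᶜ ≤
      ENNReal.ofReal (2 * Real.exp (2 - x / 4)) := by
  set T := fun ω => (spreadTime s ω).toReal
  have hfin : ∀ᵐ ω ∂protocolLaw G, spreadTime s ω ≠ ∞ := ae_spreadTime_ne_top
    (fun _ => growthRate_pos_of_mul_completeRate_le (by linarith) hlow) s
  have hle := toReal_meanSpreadTime_le hr hr1 hlow hupp s
  have hge := le_toReal_meanSpreadTime hr hr1 hlow hupp s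
  have hsub : (concentrationEvent ((r⁻¹ - r) * completeMean n + x) G s)ᶜ ≤ᵐ[protocolLaw G]
      ({ω | r⁻¹ * completeMean n + x ≤ T ω} ∪ {ω | T ω ≤ r * completeMean n - x} : Set _) := by
    filter_upwards [hfin] with ω hω hnot
    by_contra hcon
    obtain ⟨hupper, hlower⟩ := not_or.1 hcon
    rw [Set.mem_ofPred_eq, not_le] at hupper hlower
    refine hnot ⟨?_, hω, abs_le.2 ⟨?_, ?_⟩⟩
    · rw [meanSpreadTime_eq_ofReal_integral hr hr1 hlow hupp s]
      exact ENNReal.ofReal_ne_top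
    · linarith [hlower]
    · linarith [hupper]
  refine (measure_mono_ae hsub).trans ?_
  rw [← ofReal_measureReal, two_mul]
  exact ENNReal.ofReal_le_ofReal ((measureReal_union_le _ _).trans (add_le_add
    (measureReal_spreadTime_ge_le hr hlow s x)
    (measureReal_spreadTime_le_le hr hr1 hlow hupp s x)))

end GrowthRate

/-! ### Cuts of binomial random graphs -/

lemma exp_sub_one_sub_le {x : ℝ} (hx : |x| ≤ 3 / 4) : Real.exp x - 1 - x ≤ 2 / 3 * x ^ 2 := by
  have hexp := (abs_le.1 (Real.exp_bound (by linarith : |x| ≤ 1) (n := 3) (by norm_num))).2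
  have hcube : |x| ^ 3 ≤ 3 / 4 * x ^ 2 := by
    rw [pow_succ, sq_abs, mul_comm]
    gcongr
  norm_num [Finset.sum_range_succ, Nat.factorial] at hexp
  linarith

lemma measureReal_lt_abs_sub_le_of_mgf_le {Ω : Type*} [MeasurableSpace Ω] {μ : Measure Ω}
    [IsFiniteMeasure μ] {X : Ω → ℝ} {m ε : ℝ} (hm : 0 ≤ m) (hε : 0 ≤ ε) (hε' : ε ≤ 3 / 4)
    (hint : ∀ t, Integrable (fun ω => Real.exp (t * X ω)) μ)
    (hmgf : ∀ t, mgf X μ t ≤ Real.exp (m * (Real.exp t - 1))) :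
    μ.real {ω | ε * m < |X ω - m|} ≤ 2 * Real.exp (-(ε ^ 2 / 3 * m)) := by
  have htail (t : ℝ) (ht : |t| = ε) :
      Real.exp (-t * (m + t * m)) * mgf X μ t ≤ Real.exp (-(ε ^ 2 / 3 * m)) := by
    refine (mul_le_mul_of_nonneg_left (hmgf t) (Real.exp_pos _).le).trans ?_
    rw [← Real.exp_add, Real.exp_le_exp, ← ht, sq_abs]
    linarith [mul_le_mul_of_nonneg_left (exp_sub_one_sub_le (ht.trans_le hε')) hm]
  have hupper := (measure_ge_le_exp_mul_mgf (m + ε * m) hε (hint ε)).trans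
    (htail ε (abs_of_nonneg hε))
  have hlower := (measure_le_le_exp_mul_mgf (m + -ε * m) (neg_nonpos.2 hε) (hint (-ε))).trans
    (htail (-ε) (by rw [abs_neg, abs_of_nonneg hε]))
  rw [two_mul]
  refine (measureReal_mono fun ω hω => ?_).trans
    ((measureReal_union_le _ _).trans (add_le_add hupper hlower))
  rw [Set.mem_ofPred_eq, lt_abs] at hω
  rcases hω with h | h
  · left
    change m + ε * m ≤ X ω
    linarith
  · right
    change X ω ≤ m + -ε * m
    linarith

instance measurableSingletonClass_simpleGraph {V : Type*} [Countable V] :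
    MeasurableSingletonClass (SimpleGraph V) where
  measurableSet_singleton G := ⟨{G.Adj}, measurableSet_singleton _, by ext H; simp⟩

section Chernoff

open scoped Classical in
lemma lintegral_prod_setBernoulli {ι : Type*} {u : Set ι} (p : I) {F : Finset ι} (hF : ↑F ⊆ u)
    (c : ℝ≥0∞) :
    ∫⁻ s, ∏ i ∈ F, (if i ∈ s then c else 1) ∂(setBernoulli u p) =
      (unitInterval.toNNReal p * c + unitInterval.toNNReal (σ p)) ^ F.card := by
  let g : Prop → ℝ≥0∞ := fun P => if P then c else 1
  have hg : Measurable g := measurable_of_countable g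
  let ν : ι → Measure Prop := fun i =>
    unitInterval.toNNReal p • Measure.dirac (i ∈ u) +
      unitInterval.toNNReal (σ p) • Measure.dirac False
  have hprob (i : ι) : IsProbabilityMeasure (ν i) := by infer_instance
  have hone (i : ι) (hi : i ∈ F) : ∫⁻ ω, g (ω i) ∂(Measure.infinitePi ν) =
      unitInterval.toNNReal p * c + unitInterval.toNNReal (σ p) := by
    have hmap : ∫⁻ ω, g (ω i) ∂(Measure.infinitePi ν) = ∫⁻ P, g P ∂(ν i) := by
      rw [← Measure.infinitePi_map_eval ν i, lintegral_map hg (by fun_prop)]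
    have hiu : i ∈ u := hF hi
    rw [hmap, lintegral_add_measure, lintegral_smul_measure, lintegral_smul_measure]
    simp [g, hiu, ENNReal.smul_def]
  have hset : setBernoulli u p = (Measure.infinitePi ν).map MeasurableEquiv.setOfPred :=
    setBernoulli_eq_map u p
  rw [hset, lintegral_map_equiv]
  change ∫⁻ ω, ∏ i ∈ F, g (ω i) ∂(Measure.infinitePi ν) = _
  rw [lintegral_prod_eq_prod_lintegral_of_indepFun F _
    (iIndepFun_infinitePi (X := fun _ => g) fun _ => hg) (fun i => by fun_prop),
    Finset.prod_congr rfl hone, Finset.prod_const]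

variable {V : Type*}

open scoped Classical in
lemma lintegral_prod_binomialRandom [Countable V] (p : I) {F : Finset (Sym2 V)}
    (hF : ∀ e ∈ F, ¬ e.IsDiag) (c : ℝ≥0∞) :
    ∫⁻ G, ∏ e ∈ F, (if e ∈ G.edgeSet then c else 1) ∂(SimpleGraph.binomialRandom V p) =
      (unitInterval.toNNReal p * c + unitInterval.toNNReal (σ p)) ^ F.card := by
  have hmeas : Measurable fun G : SimpleGraph V => ∏ e ∈ F, if e ∈ G.edgeSet then c else 1 :=
    Finset.measurable_fun_prod _ fun e _ => Measurable.ite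
      (measurableSet_setOfPred.2 (by fun_prop)) measurable_const measurable_const
  rw [SimpleGraph.binomialRandom_eq_map, lintegral_map hmeas (by fun_prop),
    ← lintegral_prod_setBernoulli p (u := Sym2.diagSetᶜ) fun e he => by simpa using hF e he]
  refine lintegral_congr fun s => Finset.prod_congr rfl fun e he => ?_
  simp [hF e he]

lemma injOn_sym2Mk {S T : Finset V} (h : Disjoint S T) :
    Set.InjOn (fun z : V × V => s(z.1, z.2)) ↑(S ×ˢ T) := by
  rintro ⟨a, b⟩ hab ⟨c, d⟩ hcd heq
  simp only [Finset.coe_product, Set.mem_prod, Finset.mem_coe] at hab hcd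
  rcases Sym2.eq_iff.1 heq with ⟨hac, hbd⟩ | ⟨had, -⟩
  · exact Prod.ext hac hbd
  · exact absurd ((show a = d from had) ▸ hab.1) (Finset.disjoint_right.1 h hcd.2)

variable [Fintype V] [DecidableEq V]

open scoped Classical in
lemma prod_ite_mem_edgeSet_eq_pow_card_interedges (G : SimpleGraph V) (S : Finset V) (c : ℝ≥0∞) :
    ∏ e ∈ (S ×ˢ Sᶜ).image (fun z => s(z.1, z.2)), (if e ∈ G.edgeSet then c else 1) =
      c ^ (G.interedges S Sᶜ).card := by
  rw [Finset.prod_image (injOn_sym2Mk disjoint_compl_right), Finset.prod_ite,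
    Finset.prod_const_one, mul_one, Finset.prod_const]
  rfl

open scoped Classical in
lemma mgf_card_interedges_le (p : I) (S : Finset V) (t : ℝ) :
    mgf (fun G : SimpleGraph V => ((G.interedges S Sᶜ).card : ℝ))
      (SimpleGraph.binomialRandom V p) t ≤
      Real.exp (p * S.card * Sᶜ.card * (Real.exp t - 1)) := by
  have hdiag : ∀ e ∈ (S ×ˢ Sᶜ).image (fun z => s(z.1, z.2)), ¬ e.IsDiag := by
    simp only [Finset.mem_image, Finset.mem_product, Finset.mem_compl, Prod.exists]
    rintro _ ⟨a, b, ⟨ha, hb⟩, rfl⟩ hab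
    exact hb ((Sym2.mk_isDiag_iff.1 hab) ▸ ha)
  have hexp (G : SimpleGraph V) : ENNReal.ofReal (Real.exp (t * (G.interedges S Sᶜ).card)) =
      ENNReal.ofReal (Real.exp t) ^ (G.interedges S Sᶜ).card := by
    rw [← ENNReal.ofReal_pow (Real.exp_pos _).le, ← Real.exp_nat_mul, mul_comm]
  have hbase : (unitInterval.toNNReal p * ENNReal.ofReal (Real.exp t) +
      unitInterval.toNNReal (σ p)).toReal = p * Real.exp t + (1 - p) := by
    rw [ENNReal.toReal_add (by finiteness) (by finiteness), ENNReal.toReal_mul,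
      ENNReal.toReal_ofReal (Real.exp_pos _).le]
    rfl
  rw [mgf, integral_eq_lintegral_of_nonneg_ae (ae_of_all _ fun G => (Real.exp_pos _).le)
    (Measurable.of_discrete.aestronglyMeasurable)]
  simp_rw [hexp, ← prod_ite_mem_edgeSet_eq_pow_card_interedges]
  rw [lintegral_prod_binomialRandom p hdiag, Finset.card_image_of_injOn
    (injOn_sym2Mk disjoint_compl_right), Finset.card_product, ENNReal.toReal_pow, hbase]
  have hone : p * Real.exp t + (1 - p) ≤ Real.exp (p * (Real.exp t - 1)) := by
    linarith [Real.add_one_le_exp (p * (Real.exp t - 1))]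
  have hnonneg : 0 ≤ p * Real.exp t + (1 - p) :=
    add_nonneg (mul_nonneg p.2.1 (Real.exp_pos _).le) (sub_nonneg.2 p.2.2)
  refine (pow_le_pow_left₀ hnonneg hone _).trans_eq ?_
  rw [← Real.exp_nat_mul]
  push_cast
  ring_nf

/-- The event that, in a random graph with edge probability `p`, the number of edges between `S` and
its complement deviates from its mean by more than a factor `1 ± ε`. -/
def irregularCut (p : I) (ε : ℝ) (S : Finset V) : Set (SimpleGraph V) :=
  open scoped Classical in
  {G | ε * (p * S.card * Sᶜ.card) < |((G.interedges S Sᶜ).card : ℝ) - p * S.card * Sᶜ.card|}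

lemma irregularCut_compl (p : I) (ε : ℝ) (S : Finset V) :
    irregularCut p ε Sᶜ = irregularCut p ε S := by
  classical
  ext G
  have := G.symm
  have hcomm : (G.interedges Sᶜ S).card = (G.interedges S Sᶜ).card := Rel.card_interedges_comm Sᶜ S
  rw [irregularCut, irregularCut, Set.mem_ofPred_eq, Set.mem_ofPred_eq, compl_compl, hcomm,
    mul_right_comm]

lemma irregularCut_empty (p : I) (ε : ℝ) : irregularCut p ε (∅ : Finset V) = ∅ := by
  ext G
  simp [irregularCut, SimpleGraph.interedges, Rel.interedges]

lemma measureReal_irregularCut_le (p : I) (S : Finset V) {ε : ℝ} (hε : 0 ≤ ε)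
    (hε' : ε ≤ 3 / 4) :
    (SimpleGraph.binomialRandom V p).real (irregularCut p ε S) ≤
      2 * Real.exp (-(ε ^ 2 / 3 * (p * S.card * Sᶜ.card))) := by
  have hp := p.2.1
  exact measureReal_lt_abs_sub_le_of_mgf_le (by positivity) hε hε' (fun t => .of_finite)
    (mgf_card_interedges_le p S)

end Chernoff

lemma measureReal_irregularCut_le_pow {p : I} {a : ℝ} (ha : 16 ≤ a)
    (hp : (p : ℝ) = a * Real.log n / n) {S : Finset (Fin n)} (hS : S.Nonempty)
    (hSn : 2 * S.card ≤ n) :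
    (SimpleGraph.binomialRandom (Fin n) p).real (irregularCut p √(8 / a) S) ≤
      2 * ((n : ℝ) ^ (-(4 / 3) : ℝ)) ^ S.card := by
  have hn : (0 : ℝ) < n := by
    have := hS.card_pos
    exact_mod_cast (by omega : 0 < n)
  have : 0 ≤ Real.log n := Real.log_natCast_nonneg n
  have hε : √(8 / a) ≤ 3 / 4 := by
    rw [Real.sqrt_le_left (by norm_num), div_le_iff₀ (by linarith)]
    linarith
  have hcompl : (n : ℝ) / 2 ≤ Sᶜ.card := by
    rw [div_le_iff₀ two_pos, Finset.card_compl, Fintype.card_fin]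
    exact_mod_cast (by omega : n ≤ (n - S.card) * 2)
  refine (measureReal_irregularCut_le p S (Real.sqrt_nonneg _) hε).trans ?_
  rw [Real.sq_sqrt (by positivity), hp, Real.rpow_def_of_pos hn, ← Real.exp_nat_mul]
  gcongr
  calc S.card * (Real.log n * -(4 / 3))
      = -(8 / a / 3 * (a * Real.log n / n * S.card * (n / 2))) := by
        field_simp
        ring
    _ ≥ -(8 / a / 3 * (a * Real.log n / n * S.card * Sᶜ.card)) := by gcongr

lemma setOf_not_uniformCuts_subset {p : I} {a : ℝ} (hp : (p : ℝ) = a * Real.log n / n) :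
    {G : SimpleGraph (Fin n) | ¬ UniformCuts G a} ⊆
      ⋃ S ∈ ({S | S.Nonempty ∧ 2 * S.card ≤ n} : Finset (Finset (Fin n))),
        irregularCut p √(8 / a) S := by
  intro G hG
  simp only [Set.mem_ofPred_eq, UniformCuts, not_forall, not_le] at hG
  obtain ⟨S, hS⟩ := hG
  have hGS : G ∈ irregularCut p √(8 / a) S := by
    have hle : S.card ≤ n := by simpa using Finset.card_le_univ S
    rw [irregularCut, Set.mem_ofPred_eq, hp, Finset.card_compl, Fintype.card_fin,
      Nat.cast_sub hle]
    convert hS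
  have hmem {R : Finset (Fin n)} (hR : G ∈ irregularCut p √(8 / a) R) (hRn : 2 * R.card ≤ n) :
      G ∈ ⋃ S ∈ ({S | S.Nonempty ∧ 2 * S.card ≤ n} : Finset (Finset (Fin n))),
        irregularCut p √(8 / a) S := by
    refine Set.mem_biUnion (x := R) ?_ hR
    rcases R.eq_empty_or_nonempty with rfl | hne
    · simp [irregularCut_empty] at hR
    · simp [hne, hRn]
  rcases le_total (2 * S.card) n with h | h
  · exact hmem hGS h
  · refine hmem (R := Sᶜ) (by rwa [irregularCut_compl]) ?_
    rw [Finset.card_compl, Fintype.card_fin]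
    omega

lemma sum_pow_card_le {V : Type*} [Fintype V] {𝒮 : Finset (Finset V)} (h𝒮 : ∅ ∉ 𝒮) {x : ℝ}
    (hx : 0 ≤ x) : ∑ S ∈ 𝒮, x ^ S.card ≤ (1 + x) ^ Fintype.card V - 1 := by
  classical
  have hall : ∑ S : Finset V, x ^ S.card = (1 + x) ^ Fintype.card V := by
    simpa [add_comm] using Fintype.sum_pow_mul_eq_add_pow V x 1
  have hinsert : ∑ S ∈ insert ∅ 𝒮, x ^ S.card = 1 + ∑ S ∈ 𝒮, x ^ S.card := by
    simp [Finset.sum_insert h𝒮]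
  have hle : ∑ S ∈ insert ∅ 𝒮, x ^ S.card ≤ ∑ S : Finset V, x ^ S.card :=
    Finset.sum_le_sum_of_subset_of_nonneg (Finset.subset_univ _) fun S _ _ => by positivity
  linarith

lemma measureReal_not_uniformCuts_le {p : I} {a : ℝ} (ha : 16 ≤ a)
    (hp : (p : ℝ) = a * Real.log n / n) :
    (SimpleGraph.binomialRandom (Fin n) p).real {G | ¬ UniformCuts G a} ≤
      2 * ((1 + (n : ℝ) ^ (-(4 / 3) : ℝ)) ^ n - 1) := by
  let 𝒮 : Finset (Finset (Fin n)) := {S | S.Nonempty ∧ 2 * S.card ≤ n}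
  have h𝒮 : ∅ ∉ 𝒮 := by simp [𝒮]
  calc (SimpleGraph.binomialRandom (Fin n) p).real {G | ¬ UniformCuts G a}
      ≤ (SimpleGraph.binomialRandom (Fin n) p).real (⋃ S ∈ 𝒮, irregularCut p √(8 / a) S) :=
        measureReal_mono (setOf_not_uniformCuts_subset hp) (measure_ne_top _ _)
    _ ≤ ∑ S ∈ 𝒮, (SimpleGraph.binomialRandom (Fin n) p).real (irregularCut p √(8 / a) S) :=
        measureReal_biUnion_finset_le _ _
    _ ≤ ∑ S ∈ 𝒮, 2 * ((n : ℝ) ^ (-(4 / 3) : ℝ)) ^ S.card :=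
        Finset.sum_le_sum fun S hS =>
          have hS' := (Finset.mem_filter.1 hS).2
          measureReal_irregularCut_le_pow ha hp hS'.1 hS'.2
    _ ≤ 2 * ((1 + (n : ℝ) ^ (-(4 / 3) : ℝ)) ^ n - 1) := by
        rw [← Finset.mul_sum]
        gcongr
        simpa using sum_pow_card_le h𝒮 (Real.rpow_nonneg n.cast_nonneg (-(4 / 3)))

lemma tendsto_one_add_rpow_pow_sub_one :
    Tendsto (fun n : ℕ => 2 * ((1 + (n : ℝ) ^ (-(4 / 3) : ℝ)) ^ n - 1)) atTop (𝓝 0) := by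
  have hmul : Tendsto (fun n : ℕ => (n : ℝ) * (n : ℝ) ^ (-(4 / 3) : ℝ)) atTop (𝓝 0) := by
    refine ((tendsto_rpow_neg_atTop (by norm_num : (0 : ℝ) < 1 / 3)).comp
      tendsto_natCast_atTop_atTop).congr fun n => ?_
    rw [Function.comp_apply, ← Real.rpow_one_add' n.cast_nonneg (by norm_num)]
    norm_num
  simpa using ((Real.tendsto_one_add_pow_exp_of_tendsto hmul).sub_const 1).const_mul 2

/-! ### Spreading times in graphs with uniform cuts -/

lemma harmonic_pred_le (hn : 3 ≤ n) : (harmonic (n - 1) : ℝ) ≤ 2 * Real.log n := by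
  have hharmonic := harmonic_le_one_add_log (n - 1)
  have hn3 : (3 : ℝ) ≤ n := by exact_mod_cast hn
  have hlog : Real.log ((n - 1 : ℕ) : ℝ) ≤ Real.log n :=
    Real.log_le_log (by exact_mod_cast (by omega : 0 < n - 1)) (by exact_mod_cast Nat.sub_le n 1)
  have hone : 1 ≤ Real.log n := by
    rw [Real.le_log_iff_exp_le (by linarith)]
    linarith [Real.exp_one_lt_d9]
  linarith

lemma completeMean_nonneg (n : ℕ) : 0 ≤ completeMean n :=
  Finset.sum_nonneg fun _ hk => inv_nonneg.2 (zero_le_one.trans (one_le_completeRate hk))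

lemma completeMean_le (hn : 3 ≤ n) : completeMean n ≤ 2 * Real.log n := by
  have hn0 : (0 : ℝ) < n := by exact_mod_cast (by omega : 0 < n)
  have hfrac : ((n : ℝ) - 1) / n ≤ 1 := (div_le_one hn0).2 (by linarith)
  have hharmonic : (0 : ℝ) ≤ harmonic (n - 1) := by exact_mod_cast (harmonic_pos (by omega)).le
  rw [completeMean_eq]
  exact (mul_le_of_le_one_left hharmonic hfrac).trans (harmonic_pred_le hn)

lemma sqrt_eight_div_le {a : ℝ} (ha : 12800 ≤ a) : √(8 / a) ≤ 1 / 40 := by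
  rw [Real.sqrt_le_left (by norm_num), div_le_iff₀ (by linarith)]
  linarith

lemma mul_sqrt_eight_div_lt {a : ℝ} (ha : 0 < a) : 2.06 * √(8 / a) < √(34 / a) := by
  refine Real.lt_sqrt_of_sq_lt ?_
  rw [mul_pow, Real.sq_sqrt (by positivity), ← mul_div_assoc]
  gcongr
  norm_num

lemma one_sub_two_mul_le_div {ε : ℝ} (hε : 0 ≤ ε) : 1 - 2 * ε ≤ (1 - ε) / (1 + ε) := by
  rw [le_div_iff₀ (by linarith)]
  nlinarith

lemma inv_div_le_one_add {ε : ℝ} (hε : 0 ≤ ε) (hε' : ε ≤ 1 / 40) :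
    ((1 - ε) / (1 + ε))⁻¹ ≤ 1 + 2.06 * ε := by
  rw [inv_div, div_le_iff₀ (by linarith)]
  nlinarith

namespace UniformCuts

variable {G : SimpleGraph (Fin n)} {a : ℝ}

section

variable (h : UniformCuts G a) (ha : 12800 ≤ a) (hn : 2 ≤ n)

include h ha hn

lemma exists_ratio : ∃ r : ℝ, 1 - 2 * √(8 / a) ≤ r ∧ r⁻¹ ≤ 1 + 2.06 * √(8 / a) ∧ 1 / 2 ≤ r ∧
    r ≤ 1 ∧ (∀ S, r * completeRate n S.card ≤ growthRate G S) ∧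
      ∀ S, growthRate G S ≤ r⁻¹ * completeRate n S.card := by
  have hε := sqrt_eight_div_le ha
  have hε0 : 0 ≤ √(8 / a) := Real.sqrt_nonneg _
  have hlow := one_sub_two_mul_le_div hε0
  refine ⟨(1 - √(8 / a)) / (1 + √(8 / a)), hlow, inv_div_le_one_add hε0 hε, by linarith,
    (div_le_one (by linarith)).2 (by linarith),
    h.mul_completeRate_le_growthRate (by linarith) (by linarith) hn, ?_⟩
  rw [inv_div]
  exact h.growthRate_le_mul_completeRate (by linarith) (by linarith) hn

lemma meanSpreadTime_ne_top (s : Fin n) : meanSpreadTime G s ≠ ∞ := by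
  obtain ⟨r, -, -, hr, hr1, hlow, hupp⟩ := h.exists_ratio ha hn
  rw [meanSpreadTime_eq_ofReal_integral hr hr1 hlow hupp s]
  exact ENNReal.ofReal_ne_top

lemma abs_toReal_meanSpreadTime_sub_le (s : Fin n) :
    |(meanSpreadTime G s).toReal - completeMean n| ≤ 2.06 * √(8 / a) * completeMean n := by
  obtain ⟨r, hrε, hrε', hr, hr1, hlow, hupp⟩ := h.exists_ratio ha hn
  have hmean := completeMean_nonneg n
  have hle := (toReal_meanSpreadTime_le hr hr1 hlow hupp s).trans
    (mul_le_mul_of_nonneg_right hrε' hmean)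
  have hge := (mul_le_mul_of_nonneg_right hrε hmean).trans
    (le_toReal_meanSpreadTime hr hr1 hlow hupp s)
  have : 0 ≤ √(8 / a) * completeMean n := by positivity
  rw [abs_le]
  constructor <;> linarith

end

lemma meanBound (h : UniformCuts G a) (ha : 12800 ≤ a) (hn : 3 ≤ n) (s : Fin n) :
    MeanBound 30 a G s := by
  have hn1 : (0 : ℝ) < n - 1 := sub_pos.2 (by exact_mod_cast (by omega : 1 < n))
  have : (0 : ℝ) < n := by linarith
  have hharmonic : (0 : ℝ) < harmonic (n - 1) := by exact_mod_cast harmonic_pos (by omega)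
  have hdev := h.abs_toReal_meanSpreadTime_sub_le ha (by omega) s
  have hε := sqrt_eight_div_le ha
  set E := (meanSpreadTime G s).toReal
  -- `completeMean n` is `H_{n-1}` up to the factor `(n - 1) / n`, which `y` compensates.
  refine ⟨h.meanSpreadTime_ne_top ha (by omega) s, n / (n - 1) * E, ?_, ?_⟩
  · have hscale : (n : ℝ) / (n - 1) * completeMean n = harmonic (n - 1) := by
      rw [completeMean_eq]
      field_simp
    calc |n / (n - 1) * E - harmonic (n - 1)|
        = n / (n - 1) * |E - completeMean n| := by
          rw [← hscale, ← mul_sub, abs_mul, abs_of_pos (by positivity)]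
      _ ≤ n / (n - 1) * (2.06 * √(8 / a) * completeMean n) := by gcongr
      _ = 2.06 * √(8 / a) * harmonic (n - 1) := by rw [← hscale]; ring
      _ < √(34 / a) * harmonic (n - 1) := by
        gcongr
        exact mul_sqrt_eight_div_lt (by linarith)
  · have : 0 ≤ E := ENNReal.toReal_nonneg
    have hmean := completeMean_nonneg n
    have hE : E ≤ 4 * Real.log n := by
      have hεmean := mul_le_mul_of_nonneg_right hε hmean
      linarith [(abs_le.1 hdev).2, completeMean_le hn]
    have hinv : ((n : ℝ) - 1)⁻¹ ≤ 2 / n := by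
      rw [inv_le_comm₀ hn1 (by positivity), inv_div]
      have : (3 : ℝ) ≤ n := by exact_mod_cast hn
      linarith
    calc |E - n / (n - 1) * E| = E * ((n : ℝ) - 1)⁻¹ := by
          rw [show E - n / (n - 1) * E = -(E * ((n : ℝ) - 1)⁻¹) by field_simp; ring, abs_neg,
            abs_of_nonneg (by positivity)]
      _ ≤ 4 * Real.log n * (2 / n) := by gcongr
      _ = 8 * (Real.log n / n) := by ring
      _ ≤ 30 * (Real.log n / n) := by
        gcongr
        norm_num

lemma protocolLaw_compl_concentrationEvent_le (h : UniformCuts G a) (ha : 12800 ≤ a) (hn : 3 ≤ n)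
    (s : Fin n) (x : ℝ) :
    protocolLaw G (concentrationEvent (30 * (Real.log n / √a) + x) G s)ᶜ ≤
      ENNReal.ofReal (2 * Real.exp (2 - x / 4)) := by
  obtain ⟨r, hrε, hrε', hr, hr1, hlow, hupp⟩ := h.exists_ratio ha (by omega)
  have hsqrt : √(8 / a) ≤ 3 / √a := by
    rw [Real.sqrt_div (by norm_num)]
    gcongr
    rw [Real.sqrt_le_left (by norm_num)]
    norm_num
  have hmean := completeMean_nonneg n
  have hradius : (r⁻¹ - r) * completeMean n ≤ 30 * (Real.log n / √a) :=
    calc (r⁻¹ - r) * completeMean n ≤ (5 * (3 / √a)) * (2 * Real.log n) := by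
          gcongr
          · linarith [Real.sqrt_nonneg (8 / a)]
          · exact completeMean_le hn
      _ = 30 * (Real.log n / √a) := by ring
  refine (measure_mono (Set.compl_subset_compl.2 fun ω hω => ?_)).trans
    (RumorSpreading.protocolLaw_compl_concentrationEvent_le hr hr1 hlow hupp s x)
  exact ⟨hω.1, hω.2.1, hω.2.2.trans (by linarith)⟩

end UniformCuts

/-! ### Limits -/

lemma ofReal_one_sub_le_of_compl {Ω : Type*} [MeasurableSpace Ω] {μ : Measure Ω}
    [IsProbabilityMeasure μ] {E : Set Ω} {δ : ℝ} (hδ : 0 ≤ δ) (h : μ Eᶜ ≤ ENNReal.ofReal δ) :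
    ENNReal.ofReal (1 - δ) ≤ μ E := by
  rw [ENNReal.ofReal_sub _ hδ, ENNReal.ofReal_one, tsub_le_iff_right]
  calc 1 = μ (E ∪ Eᶜ) := by rw [Set.union_compl_self, measure_univ]
    _ ≤ μ E + μ Eᶜ := measure_union_le _ _
    _ ≤ μ E + ENNReal.ofReal δ := by gcongr

lemma ofReal_one_sub_le_lintegral {Ω : Type*} [MeasurableSpace Ω] {μ : Measure Ω} {E : Set Ω}
    {f : Ω → ℝ≥0∞} (hf : Measurable f) {δ : ℝ} (hδ : 0 < δ) (hE : ENNReal.ofReal (1 - δ / 2) ≤ μ E)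
    (hfE : ∀ ω ∈ E, ENNReal.ofReal (1 - δ / 2) ≤ f ω) :
    ENNReal.ofReal (1 - δ) ≤ ∫⁻ ω, f ω ∂μ := by
  rcases le_or_gt 1 δ with h1 | h1
  · rw [ENNReal.ofReal_of_nonpos (by linarith)]
    exact zero_le
  calc ENNReal.ofReal (1 - δ) ≤ ENNReal.ofReal (1 - δ / 2) * ENNReal.ofReal (1 - δ / 2) := by
        rw [← ENNReal.ofReal_mul (by linarith)]
        exact ENNReal.ofReal_le_ofReal (by nlinarith)
    _ ≤ ENNReal.ofReal (1 - δ / 2) * μ E := by gcongr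
    _ = ∫⁻ _ in E, ENNReal.ofReal (1 - δ / 2) ∂μ := by rw [setLIntegral_const]
    _ ≤ ∫⁻ ω in E, f ω ∂μ := setLIntegral_mono hf hfE
    _ ≤ ∫⁻ ω, f ω ∂μ := setLIntegral_le_lintegral _ _

lemma tendsto_measure_one_of_forall_ofReal_le {Ω : ℕ → Type*} [∀ n, MeasurableSpace (Ω n)]
    {μ : ∀ n, Measure (Ω n)} [∀ n, IsProbabilityMeasure (μ n)] {E : ∀ n, Set (Ω n)}
    (h : ∀ δ : ℝ, 0 < δ → ∀ᶠ n in atTop, ENNReal.ofReal (1 - δ) ≤ μ n (E n)) :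
    Tendsto (fun n => μ n (E n)) atTop (𝓝 1) := by
  refine tendsto_order.2 ⟨fun b hb => ?_, fun b hb => .of_forall fun n => prob_le_one.trans_lt hb⟩
  have hb_top : b ≠ ∞ := (hb.trans ENNReal.one_lt_top).ne
  have hb_real : b.toReal < 1 := by
    simpa using (ENNReal.toReal_lt_toReal hb_top ENNReal.one_ne_top).2 hb
  filter_upwards [h ((1 - b.toReal) / 2) (by linarith)] with n hn
  exact ((ENNReal.lt_ofReal_iff_toReal_lt hb_top).2 (by linarith)).trans_le hn

section Limits

variable {α : ℕ → ℝ} (hα : ∀ᶠ n in atTop, 12800 ≤ α n)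

include hα

lemma eventually_meanBound : ∀ᶠ n : ℕ in atTop, ∀ G : SimpleGraph (Fin n), UniformCuts G (α n) →
    ∀ s, MeanBound 30 (α n) G s := by
  filter_upwards [hα, eventually_ge_atTop 3] with n ha hn G hG s
  exact hG.meanBound ha hn s

lemma eventually_le_protocolLaw_concentrationEvent {ψ : ℕ → ℝ} (hψ : Tendsto ψ atTop atTop)
    {δ : ℝ} (hδ : 0 < δ) :
    ∀ᶠ n : ℕ in atTop, ∀ G : SimpleGraph (Fin n), UniformCuts G (α n) →
      ∀ s, ENNReal.ofReal (1 - δ) ≤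
        protocolLaw G (concentrationEvent (30 * (Real.log n / √(α n)) + ψ n) G s) := by
  have hexp : Tendsto (fun n => 2 * Real.exp (2 - ψ n / 4)) atTop (𝓝 0) := by
    have hbot : Tendsto (fun n => 2 - ψ n / 4) atTop atBot := by
      simp only [sub_eq_add_neg]
      exact tendsto_atBot_add_const_left _ _
        (tendsto_neg_atTop_atBot.comp (hψ.atTop_div_const (by norm_num)))
    simpa using (Real.tendsto_exp_atBot.comp hbot).const_mul 2
  filter_upwards [hα, eventually_ge_atTop 3, hexp.eventually_le_const hδ] with n ha hn hle G hG s
  exact ofReal_one_sub_le_of_compl hδ.le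
    ((hG.protocolLaw_compl_concentrationEvent_le ha hn s (ψ n)).trans
      (ENNReal.ofReal_le_ofReal hle))

variable {p : ℕ → I} (hp : ∀ᶠ n : ℕ in atTop, (p n : ℝ) = α n * Real.log n / n)

include hp

lemma eventually_le_binomialRandom_uniformCuts {δ : ℝ} (hδ : 0 < δ) :
    ∀ᶠ n : ℕ in atTop, ENNReal.ofReal (1 - δ) ≤
      SimpleGraph.binomialRandom (Fin n) (p n) {G | UniformCuts G (α n)} := by
  filter_upwards [hα, hp, tendsto_one_add_rpow_pow_sub_one.eventually_le_const hδ]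
    with n ha hpn hle
  refine ofReal_one_sub_le_of_compl hδ.le ?_
  rw [← ofReal_measureReal]
  exact ENNReal.ofReal_le_ofReal ((measureReal_not_uniformCuts_le (by linarith) hpn).trans hle)

lemma tendsto_binomialRandom_meanBound :
    Tendsto (fun n : ℕ => SimpleGraph.binomialRandom (Fin n) (p n)
      {G | ∀ s, MeanBound 30 (α n) G s}) atTop (𝓝 1) := by
  refine tendsto_measure_one_of_forall_ofReal_le fun δ hδ => ?_
  filter_upwards [eventually_meanBound hα, eventually_le_binomialRandom_uniformCuts hα hp hδ]
    with n hmean hcuts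
  exact hcuts.trans (measure_mono fun G hG => hmean G hG)

lemma eventually_le_lintegral_concentrationEvent {ψ : ℕ → ℝ} (hψ : Tendsto ψ atTop atTop)
    {δ : ℝ} (hδ : 0 < δ) :
    ∀ᶠ n : ℕ in atTop, ∀ s : SimpleGraph (Fin n) → Fin n,
      ENNReal.ofReal (1 - δ) ≤
        ∫⁻ G, protocolLaw G (concentrationEvent (30 * (Real.log n / √(α n)) + ψ n) G (s G))
          ∂(SimpleGraph.binomialRandom (Fin n) (p n)) := by
  filter_upwards [eventually_le_protocolLaw_concentrationEvent hα hψ (half_pos hδ),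
    eventually_le_binomialRandom_uniformCuts hα hp (half_pos hδ)] with n hconc hcuts s
  exact ofReal_one_sub_le_lintegral .of_discrete hδ hcuts fun G hG => hconc G hG (s G)

end Limits

end RumorSpreading

open RumorSpreading in
theorem theorem1_general :
    ∃ C : ℝ, ∀ α : ℕ → ℝ, (∀ᶠ n in atTop, 12800 ≤ α n) →
      (∀ p : ℕ → I, (∀ᶠ n : ℕ in atTop, (p n : ℝ) = α n * Real.log n / n) →
        Tendsto
            (fun n : ℕ => SimpleGraph.binomialRandom (Fin n) (p n)
              {G | ∀ s, MeanBound C (α n) G s})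
            atTop (𝓝 1) ∧
          ∀ ψ : ℕ → ℝ, Tendsto ψ atTop atTop → ∀ δ : ℝ, 0 < δ →
            ∀ᶠ n : ℕ in atTop, ∀ s : SimpleGraph (Fin n) → Fin n,
              ENNReal.ofReal (1 - δ) ≤
                ∫⁻ G, protocolLaw G
                    (concentrationEvent (C * (Real.log n / √(α n)) + ψ n) G (s G))
                  ∂(SimpleGraph.binomialRandom (Fin n) (p n))) ∧
      (∀ᶠ n : ℕ in atTop, ∀ G : SimpleGraph (Fin n), UniformCuts G (α n) →
        ∀ s, MeanBound C (α n) G s) ∧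
      (∀ ψ : ℕ → ℝ, Tendsto ψ atTop atTop → ∀ δ : ℝ, 0 < δ →
        ∀ᶠ n : ℕ in atTop, ∀ G : SimpleGraph (Fin n), UniformCuts G (α n) →
          ∀ s, ENNReal.ofReal (1 - δ) ≤
            protocolLaw G
              (concentrationEvent (C * (Real.log n / √(α n)) + ψ n) G s)) :=
  ⟨30, fun _ hα =>
    ⟨fun _ hp => ⟨tendsto_binomialRandom_meanBound hα hp,
      fun _ hψ _ hδ => eventually_le_lintegral_concentrationEvent hα hp hψ hδ⟩,
    eventually_meanBound hα,
    fun _ hψ _ hδ => eventually_le_protocolLaw_concentrationEvent hα hψ hδ⟩⟩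

open RumorSpreading in
theorem theorem1 (α : ℕ → ℝ) (hα : Tendsto α atTop atTop) :
    ∃ C : ℝ,
      -- the random graph with edge probability `p = α ln n / n`
      (∀ p : ℕ → I, (∀ᶠ n : ℕ in atTop, (p n : ℝ) = α n * Real.log n / n) →
        Tendsto
            (fun n : ℕ => SimpleGraph.binomialRandom (Fin n) (p n)
              {G | ∀ s, MeanBound C (α n) G s})
            atTop (𝓝 1) ∧
          ∀ ψ : ℕ → ℝ, Tendsto ψ atTop atTop → ∀ δ : ℝ, 0 < δ →
            ∀ᶠ n : ℕ in atTop, ∀ s : SimpleGraph (Fin n) → Fin n,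
              ENNReal.ofReal (1 - δ) ≤
                ∫⁻ G, protocolLaw G
                    (concentrationEvent (C * (Real.log n / √(α n)) + ψ n) G (s G))
                  ∂(SimpleGraph.binomialRandom (Fin n) (p n))) ∧
      -- every graph with uniform cuts
      (∀ᶠ n : ℕ in atTop, ∀ G : SimpleGraph (Fin n), UniformCuts G (α n) →
        ∀ s, MeanBound C (α n) G s) ∧
      (∀ ψ : ℕ → ℝ, Tendsto ψ atTop atTop → ∀ δ : ℝ, 0 < δ →
        ∀ᶠ n : ℕ in atTop, ∀ G : SimpleGraph (Fin n), UniformCuts G (α n) →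
          ∀ s, ENNReal.ofReal (1 - δ) ≤
            protocolLaw G
              (concentrationEvent (C * (Real.log n / √(α n)) + ψ n) G s)) := by
  obtain ⟨C, hC⟩ := theorem1_general
  exact ⟨C, hC α (hα.eventually_ge_atTop 12800)⟩
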